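/- Let $X$ be a (real or complex) Hilbert space and let $T>0$. For each $t\in[0,T]$ let $(\cdot,\cdot)_t$ be an inner product on $X$ whose norm $\|\cdot\|_t$ is equivalent to the norm of $X$, and suppose that there is $c>0$ such that, for every $u\in X$, the function $t\mapsto (u,u)_t$ is differentiable on $[0,T]$ with $$\frac{d}{dt}(u,u)_t\le 2c\,(u,u)_t\qquad\text{for all } t\in[0,T].$$ For each $t\in[0,T]$ let $A(t)$ be a single-valued (in general nonlinear) operator in $X$ with the following properties. (i) There is $\omega\ge 0$, independent of $t$, such that for every $t\in[0,T]$ the operator $A(t)+\omega\mathbb{I}$ is maximal monotone for $(\cdot,\cdot)_t$, i.e. its graph $G_t=\{(u,A(t)u+\omega u): u\in D(A(t))\}$ satisfies $\Re\,(y_1-y_2,x_1-x_2)_t\ge 0$ for all $(x_1,y_1),(x_2,y_2)\in G_t$, and no strictly larger subset of $X\times X$ has this property. (ii) The domain $D(A(t))=D$ is independent of $t\in[0,T]$. (iii) There is $L>0$ such that $$\|A(t)u-A(s)u\|_0\le L\,|t-s|\,\bigl(1+\|u\|_0+\|A(s)u\|_0\bigr)\qquad\text{for all } u\in D,\ s,t\in[0,T].$$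 Then for every $a\in D$ the Cauchy problem $$\frac{du}{dt}(t)+A(t)u(t)=0\quad (0\le t\le T),\qquad u(0)=a,$$ has a unique solution $u\in C([0,T];X)$, in the following sense. There is a Lipschitz continuous function $u:[0,T]\to X$ with $u(0)=a$ and $u(t)\in D$ for all $t\in[0,T]$, and a countable set $N\subset[0,T]$ such that, for every $t\in[0,T]\setminus N$, the strong derivative $\frac{du}{dt}(t)$ (one-sided at $t=0$ and $t=T$) exists and equals $-A(t)u(t)$, and the map $s\mapsto -A(s)u(s)$, $[0,T]\to X$, is continuous at $t$. Moreover, every $v\in C([0,T];X)$ with $v(0)=a$, with $v(t)\in D$ for all $t\in[0,T]$, and with strong derivative $\frac{dv}{dt}(t)=-A(t)v(t)$ at all but countably many $t\in[0,T]$ coincides with $u$ on $[0,T]$. -/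

import Mathlib

/-- The norm associated with an inner product `I` on `X` (not necessarily the one that `X` is
equipped with). -/
noncomputable def ipNorm {𝕜 X : Type*} [RCLike 𝕜] [AddCommGroup X] [Module 𝕜 X]
    (I : InnerProductSpace.Core 𝕜 X) (u : X) : ℝ :=
  √(RCLike.re (I.inner u u))

/-- The norm of the inner product `I` is equivalent to the given norm of `X`. -/
def IsEquivalentIP {𝕜 X : Type*} [RCLike 𝕜] [NormedAddCommGroup X] [NormedSpace 𝕜 X]
    (I : InnerProductSpace.Core 𝕜 X) : Prop :=
  ∃ m M : ℝ, 0 < m ∧ ∀ u : X, m * ‖u‖ ≤ ipNorm I u ∧ ipNorm I u ≤ M * ‖u‖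

/-- Monotonicity, for the inner product `I`, of a possibly multivalued operator given by
its graph `G`: `Re (y₁ - y₂, x₁ - x₂) ≥ 0` for all `(x₁, y₁), (x₂, y₂) ∈ G`. -/
def IsMonotoneOperator {𝕜 X : Type*} [RCLike 𝕜] [AddCommGroup X] [Module 𝕜 X]
    (I : InnerProductSpace.Core 𝕜 X) (G : Set (X × X)) : Prop :=
  ∀ p ∈ G, ∀ q ∈ G, 0 ≤ RCLike.re (I.inner (p.2 - q.2) (p.1 - q.1))

/-- A maximal monotone operator: a monotone graph with no proper monotone extension. -/
def IsMaximalMonotoneOperator {𝕜 X : Type*} [RCLike 𝕜] [AddCommGroup X] [Module 𝕜 X]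
    (I : InnerProductSpace.Core 𝕜 X) (G : Set (X × X)) : Prop :=
  Maximal (IsMonotoneOperator I) G

/-- `B + ω` is maximal monotone for the inner product `I`, where `B` is the single-valued
operator with domain `D` (its values outside `D` are irrelevant). -/
def IsMaximalQuasiMonotone {𝕜 X : Type*} [RCLike 𝕜] [AddCommGroup X] [Module 𝕜 X]
    (I : InnerProductSpace.Core 𝕜 X) (ω : ℝ) (D : Set X) (B : X → X) : Prop :=
  IsMaximalMonotoneOperator I (Set.graphOn (fun u => B u + (ω : 𝕜) • u) D)

/-- `u' + A(t) u = 0` on `[0, T]`, `u(0) = a`: `u` is continuous, takes its values in `D`, and has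
the strong derivative `-A(t) u(t)` at all but countably many `t` (one-sided at `0` and `T`). -/
structure IsCauchySolution {X : Type*} [NormedAddCommGroup X] [NormedSpace ℝ X]
    (T : ℝ) (D : Set X) (A : ℝ → X → X) (a : X) (u : ℝ → X) : Prop where
  continuousOn : ContinuousOn u (Set.Icc 0 T)
  initial : u 0 = a
  mem_domain : ∀ t ∈ Set.Icc 0 T, u t ∈ D
  equation : ∃ N : Set ℝ, N.Countable ∧
    ∀ t ∈ Set.Icc 0 T \ N, HasDerivWithinAt u (-(A t (u t))) (Set.Icc 0 T) t

/-!
The solution is a limit of implicit Euler schemes `z + δ A(t) z = y`, whose steps are solvable by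
Minty's theorem. Quasi-monotonicity, the growth of the norms and the Lipschitz dependence of `A(t)`
on `t` bound the growth of the graph norm `1 + ‖z‖_t + ‖A(t) z‖_t` along a scheme by a fixed
exponential rate; by a Gronwall estimate, two schemes whose step errors tend to `0` therefore have
the same limit `u`. Since graphs of maximal monotone operators are closed under strong convergence
of `z` and weak convergence of `A(t) z`, the function `u` stays in `D` and its graph norm
`1 + ‖u(t)‖_t + ‖A(t) u(t)‖_t`, divided by that exponential, is nonincreasing. Hence the graph norm
has at most countably many discontinuities. At each point where it is continuous, weak convergence
of `A(s) u(s)` together with convergence of its norm gives strong convergence, so that `A(s) u(s)`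
is continuous there. Applied to right limits, the same argument gives the right derivative
`-A(t) u(t)` at every `t < T`, and it is a two-sided derivative wherever it is continuous.

A complex inner product enters only through its real part, which is a symmetric real bilinear form.
-/

open Set Filter Topology

section Forms

variable {X : Type*} [NormedAddCommGroup X] [NormedSpace ℝ X]

/-- The seminorm `√(b u u)` of a nonnegative bilinear form `b`. -/
noncomputable def formNorm (b : X →L[ℝ] X →L[ℝ] ℝ) (u : X) : ℝ := √(b u u)

/-- A symmetric bilinear form whose norm is equivalent to the norm of `X`; a single constant `κ`
controls both directions, so that a family of forms is uniformly equivalent to the norm of `X`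
when all its members have the same `κ`. -/
structure IsCoerciveForm (κ : ℝ) (b : X →L[ℝ] X →L[ℝ] ℝ) : Prop where
  pos : 0 < κ
  symm : ∀ u v, b u v = b v u
  nonneg : ∀ u, 0 ≤ b u u
  norm_le : ∀ u, ‖u‖ ≤ κ * formNorm b u
  le_norm : ∀ u, formNorm b u ≤ κ * ‖u‖

lemma tendsto_form_apply {ι : Type*} {l : Filter ι} {B : ι → X →L[ℝ] X →L[ℝ] ℝ}
    {b : X →L[ℝ] X →L[ℝ] ℝ} {u v : ι → X} {x y : X} (hB : Tendsto B l (𝓝 b))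
    (hu : Tendsto u l (𝓝 x)) (hv : Tendsto v l (𝓝 y)) :
    Tendsto (fun i => B i (u i) (v i)) l (𝓝 (b x y)) :=
  (isBoundedBilinearMap_apply.continuous.tendsto (b x, y)).comp
    (((isBoundedBilinearMap_apply.continuous.tendsto (b, x)).comp (hB.prodMk_nhds hu)).prodMk_nhds
      hv)

lemma formNorm_nonneg (b : X →L[ℝ] X →L[ℝ] ℝ) (u : X) : 0 ≤ formNorm b u := Real.sqrt_nonneg _

lemma formNorm_neg (b : X →L[ℝ] X →L[ℝ] ℝ) (u : X) : formNorm b (-u) = formNorm b u := by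
  simp [formNorm]

lemma formNorm_smul (b : X →L[ℝ] X →L[ℝ] ℝ) {r : ℝ} (hr : 0 ≤ r) (u : X) :
    formNorm b (r • u) = r * formNorm b u := by
  simp only [formNorm, map_smul, smul_apply, smul_eq_mul, ← mul_assoc]
  rw [Real.sqrt_mul (mul_nonneg hr hr), Real.sqrt_mul_self hr]

lemma tendsto_formNorm {ι : Type*} {l : Filter ι} {B : ι → X →L[ℝ] X →L[ℝ] ℝ}
    {b : X →L[ℝ] X →L[ℝ] ℝ} {u : ι → X} {x : X} (hB : Tendsto B l (𝓝 b))
    (hu : Tendsto u l (𝓝 x)) : Tendsto (fun i => formNorm (B i) (u i)) l (𝓝 (formNorm b x)) :=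
  (tendsto_form_apply hB hu hu).sqrt

lemma formNorm_le_exp_mul {b b' : X →L[ℝ] X →L[ℝ] ℝ} {r : ℝ} {u : X}
    (h : b' u u ≤ Real.exp (2 * r) * b u u) : formNorm b' u ≤ Real.exp r * formNorm b u := by
  refine (Real.sqrt_le_sqrt h).trans_eq ?_
  rw [Real.sqrt_mul (Real.exp_nonneg _), ← Real.exp_half, mul_div_cancel_left₀ _ two_ne_zero,
    formNorm]

lemma formNorm_le_add_sqrt (b b' : X →L[ℝ] X →L[ℝ] ℝ) (u : X) :
    formNorm b' u ≤ formNorm b u + √‖b' - b‖ * ‖u‖ := by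
  have hdiff : b' u u ≤ b u u + ‖b' - b‖ * ‖u‖ ^ 2 := by
    have := (le_abs_self _).trans ((b' - b).le_opNorm₂ u u)
    simp only [sub_apply] at this
    linarith
  have hsq : b u u ≤ formNorm b u ^ 2 := (le_max_left _ _).trans_eq Real.sq_sqrt'.symm
  have hcross : 0 ≤ formNorm b u * (√‖b' - b‖ * ‖u‖) := mul_nonneg (formNorm_nonneg _ _)
    (by positivity)
  refine Real.sqrt_le_iff.2 ⟨add_nonneg (formNorm_nonneg _ _) (by positivity), ?_⟩
  rw [add_sq, mul_pow, Real.sq_sqrt (norm_nonneg (b' - b))]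
  linarith

lemma formNorm_le_sqrt_norm_mul (b : X →L[ℝ] X →L[ℝ] ℝ) (u : X) :
    formNorm b u ≤ √‖b‖ * ‖u‖ := by
  rw [formNorm, ← Real.sqrt_sq (norm_nonneg u), ← Real.sqrt_mul (norm_nonneg b)]
  exact Real.sqrt_le_sqrt (((le_abs_self _).trans (b.le_opNorm₂ u u)).trans_eq (by ring))

namespace IsCoerciveForm

variable {κ : ℝ} {b : X →L[ℝ] X →L[ℝ] ℝ}

lemma sq_formNorm (hb : IsCoerciveForm κ b) (u : X) : formNorm b u ^ 2 = b u u :=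
  Real.sq_sqrt (hb.nonneg u)

lemma sq_norm_le (hb : IsCoerciveForm κ b) (u : X) : ‖u‖ ^ 2 ≤ κ ^ 2 * b u u := by
  rw [← hb.sq_formNorm, ← mul_pow]
  exact pow_le_pow_left₀ (norm_nonneg _) (hb.norm_le u) 2

lemma eq_zero_of_apply_self_nonpos (hb : IsCoerciveForm κ b) {u : X} (hu : b u u ≤ 0) : u = 0 := by
  rw [← norm_eq_zero, ← sq_nonpos_iff]
  exact (hb.sq_norm_le u).trans (mul_nonpos_of_nonneg_of_nonpos (sq_nonneg κ) hu)

lemma abs_apply_le (hb : IsCoerciveForm κ b) (u v : X) : |b u v| ≤ formNorm b u * formNorm b v := by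
  refine abs_le_of_sq_le_sq ?_ (mul_nonneg (formNorm_nonneg _ _) (formNorm_nonneg _ _))
  rw [mul_pow, hb.sq_formNorm, hb.sq_formNorm]
  exact LinearMap.BilinForm.apply_sq_le_of_symm b.toBilinForm hb.nonneg ⟨hb.symm⟩ u v

lemma apply_le (hb : IsCoerciveForm κ b) (u v : X) : b u v ≤ formNorm b u * formNorm b v :=
  (le_abs_self _).trans (hb.abs_apply_le u v)

lemma formNorm_add_le (hb : IsCoerciveForm κ b) (u v : X) :
    formNorm b (u + v) ≤ formNorm b u + formNorm b v := by
  refine Real.sqrt_le_iff.2 ⟨add_nonneg (formNorm_nonneg _ _) (formNorm_nonneg _ _), ?_⟩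
  have := hb.apply_le u v
  simp only [add_sq, hb.sq_formNorm, map_add, add_apply, hb.symm v u]
  linarith

lemma formNorm_sub_le (hb : IsCoerciveForm κ b) (u v : X) :
    formNorm b (u - v) ≤ formNorm b u + formNorm b v := by
  simpa only [sub_eq_add_neg, formNorm_neg] using hb.formNorm_add_le u (-v)

lemma formNorm_le_sq_mul {b' : X →L[ℝ] X →L[ℝ] ℝ} (hb : IsCoerciveForm κ b)
    (hb' : IsCoerciveForm κ b') (u : X) : formNorm b' u ≤ κ ^ 2 * formNorm b u :=
  calc formNorm b' u ≤ κ * ‖u‖ := hb'.le_norm u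
    _ ≤ κ * (κ * formNorm b u) := by gcongr; exacts [hb.pos.le, hb.norm_le u]
    _ = κ ^ 2 * formNorm b u := by ring

lemma hasDerivWithinAt_apply_self (hb : IsCoerciveForm κ b) {d : ℝ → X} {d' : X} {r : ℝ}
    {S : Set ℝ} (hd : HasDerivWithinAt d d' S r) :
    HasDerivWithinAt (fun z => b (d z) (d z)) (2 * b (d r) d') S r := by
  refine ((b.hasFDerivAt.comp_hasDerivWithinAt r hd).clm_apply hd).congr_deriv ?_
  rw [hb.symm d' (d r), Function.comp_apply]
  ring

lemma apply_add_neg_le (hb : IsCoerciveForm κ b) {ω R σ ρ : ℝ} (hω : 0 ≤ ω) {q e y y' : X}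
    (hqy : -(ω * b q q) ≤ b y q) (hq : formNorm b q ≤ R) (hy' : formNorm b y' ≤ R)
    (hyy' : formNorm b (y - y') ≤ σ) (he : formNorm b e ≤ ρ) :
    b (q + e) (-y') ≤ ω * b (q + e) (q + e) + (R * σ + R * ρ + 2 * ω * R * ρ) := by
  have hR := (formNorm_nonneg _ _).trans hq
  have hσ : b q (y - y') ≤ R * σ :=
    (hb.apply_le _ _).trans (mul_le_mul hq hyy' (formNorm_nonneg _ _) hR)
  have hρ {z : X} (hz : formNorm b z ≤ R) : -(R * ρ) ≤ b z e :=
    neg_le_of_abs_le ((hb.abs_apply_le _ _).trans (mul_le_mul hz he (formNorm_nonneg _ _) hR))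
  have hqq : b q q ≤ b (q + e) (q + e) + 2 * (R * ρ) := by
    simp only [map_add, add_apply, hb.symm e q]
    linarith [hρ hq, hb.nonneg e]
  calc b (q + e) (-y') = b q (y - y') - b y q - b y' e := by
        simp only [map_add, map_neg, map_sub, add_apply, hb.symm e y', hb.symm y q]
        ring
    _ ≤ R * σ + ω * (b (q + e) (q + e) + 2 * (R * ρ)) + R * ρ := by
        linarith [hρ hy', mul_le_mul_of_nonneg_left hqq hω]
    _ = _ := by ring

lemma exists_isMinOn_add_apply_self [CompleteSpace X] (hb : IsCoerciveForm κ b) {S : Set (X × ℝ)}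
    (hconv : Convex ℝ S) (hclosed : IsClosed S) (hne : S.Nonempty)
    (hbdd : BddBelow ((fun p : X × ℝ => p.2 + b p.1 p.1) '' S)) :
    ∃ p ∈ S, IsMinOn (fun p : X × ℝ => p.2 + b p.1 p.1) S p := by
  set J : X × ℝ → ℝ := fun p => p.2 + b p.1 p.1 with hJ
  set μ := sInf (J '' S)
  have hμ : ∀ p ∈ S, μ ≤ J p := fun p hp => csInf_le hbdd ⟨p, hp, rfl⟩
  obtain ⟨v, hanti, (hvμ : Tendsto v atTop (𝓝 μ)), hv⟩ := exists_seq_tendsto_sInf (hne.image J) hbdd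
  choose p hpS hpv using hv
  obtain rfl : (fun n => J (p n)) = v := funext hpv
  have hparallelogram : ∀ n m,
      ‖(p n).1 - (p m).1‖ ^ 2 ≤ κ ^ 2 * (2 * (J (p n) - μ) + 2 * (J (p m) - μ)) := fun n m => by
    have hmid := hμ _ (hconv (hpS n) (hpS m) (a := 1 / 2) (b := 1 / 2) (by norm_num) (by norm_num)
      (by norm_num))
    refine (hb.sq_norm_le _).trans (mul_le_mul_of_nonneg_left ?_ (sq_nonneg κ))
    simp only [hJ, Prod.fst_add, Prod.snd_add, Prod.smul_fst, Prod.smul_snd, map_add, map_sub,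
      map_smul, add_apply, sub_apply, smul_apply, smul_eq_mul, hb.symm (p m).1 (p n).1] at hmid ⊢
    linarith
  have hcauchy : CauchySeq fun n => (p n).1 := by
    refine cauchySeq_of_le_tendsto_0 (fun n => √(κ ^ 2 * (4 * (J (p n) - μ)))) ?_ ?_
    · intro n m N hn hm
      rw [dist_eq_norm]
      refine Real.le_sqrt_of_sq_le ((hparallelogram n m).trans ?_)
      gcongr
      linarith [hanti hn, hanti hm]
    · simpa using (((hvμ.sub_const μ).const_mul 4).const_mul (κ ^ 2)).sqrt
  obtain ⟨x, hx⟩ := cauchySeq_tendsto_of_complete hcauchy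
  have hs : Tendsto (fun n => (p n).2) atTop (𝓝 (μ - b x x)) := by
    simpa only [hJ, add_sub_cancel_right] using
      hvμ.sub (tendsto_form_apply (tendsto_const_nhds (x := b)) hx hx)
  refine ⟨(x, μ - b x x), hclosed.mem_of_tendsto (hx.prodMk_nhds hs) (Eventually.of_forall hpS), ?_⟩
  exact isMinOn_iff.2 fun q hq => by simpa only [hJ, sub_add_cancel] using hμ q hq

lemma exists_forall_nonneg_of_convex [CompleteSpace X] (hb : IsCoerciveForm κ b) {S : Set (X × ℝ)}
    (hconv : Convex ℝ S) (hclosed : IsClosed S) (hne : S.Nonempty)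
    (hbdd : BddBelow ((fun p : X × ℝ => p.2 + b p.1 p.1) '' S)) :
    ∃ p ∈ S, ∀ q ∈ S, 0 ≤ q.2 - p.2 + 2 * b p.1 (q.1 - p.1) := by
  obtain ⟨p, hp, hmin⟩ := hb.exists_isMinOn_add_apply_self hconv hclosed hne hbdd
  refine ⟨p, hp, fun q hq => ?_⟩
  set d := q.2 - p.2 + 2 * b p.1 (q.1 - p.1) with hd
  have hlim : Tendsto (fun θ : ℝ => d + θ * b (q.1 - p.1) (q.1 - p.1)) (𝓝[>] 0) (𝓝 d) := by
    have : Tendsto (fun θ : ℝ => d + θ * b (q.1 - p.1) (q.1 - p.1)) (𝓝 0)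
        (𝓝 (d + 0 * b (q.1 - p.1) (q.1 - p.1))) := (by fun_prop : Continuous _).tendsto 0
    simpa using this.mono_left nhdsWithin_le_nhds
  refine ge_of_tendsto hlim ?_
  filter_upwards [Ioo_mem_nhdsGT one_pos] with θ hθ
  have hθmin := isMinOn_iff.1 hmin _ (hconv.add_smul_sub_mem hp hq ⟨hθ.1.le, hθ.2.le⟩)
  refine nonneg_of_mul_nonneg_right (a := θ) ?_ hθ.1
  simp only [hd, Prod.fst_add, Prod.snd_add, Prod.smul_fst, Prod.smul_snd,
    Prod.fst_sub, Prod.snd_sub, map_add, map_sub, map_smul, add_apply, sub_apply, smul_apply,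
    smul_eq_mul, hb.symm q.1 p.1] at hθmin ⊢
  linarith

lemma exists_apply_eq [CompleteSpace X] (hb : IsCoerciveForm κ b) (φ : X →L[ℝ] ℝ) :
    ∃ y, ∀ v, b y v = φ v := by
  set S : Set (X × ℝ) := {p | -2 * φ p.1 ≤ p.2} with hS
  have hconv : Convex ℝ S := by
    simpa [hS] using
      ((((-2 : ℝ) • φ).toLinearMap).convexOn convex_univ).convex_epigraph
  have hclosed : IsClosed S := isClosed_le (by fun_prop) (by fun_prop)
  have hbdd : BddBelow ((fun p : X × ℝ => p.2 + b p.1 p.1) '' S) := by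
    refine ⟨-(‖φ‖ * κ) ^ 2, ?_⟩
    rintro _ ⟨p, hp, rfl⟩
    have hφ : φ p.1 ≤ ‖φ‖ * κ * formNorm b p.1 := by
      rw [mul_assoc]
      exact (le_abs_self _).trans ((φ.le_opNorm p.1).trans (by gcongr; exact hb.norm_le _))
    have hp : -2 * φ p.1 ≤ p.2 := hp
    have hsq := sq_nonneg (formNorm b p.1 - ‖φ‖ * κ)
    rw [sub_sq, hb.sq_formNorm] at hsq
    linarith
  obtain ⟨p, hp, hvar⟩ := hb.exists_forall_nonneg_of_convex hconv hclosed ⟨0, by simp [hS]⟩ hbdd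
  have hle : ∀ v, φ v ≤ b p.1 v := fun v => by
    have hv := hvar (p.1 + v, -2 * φ (p.1 + v)) (mem_ofPred.2 le_rfl)
    have hp : -2 * φ p.1 ≤ p.2 := hp
    simp only [map_add, add_sub_cancel_left] at hv
    linarith
  refine ⟨p.1, fun v => le_antisymm ?_ (hle v)⟩
  simpa only [map_neg, neg_le_neg_iff] using hle (-v)

lemma exists_tendsto_apply_of_formNorm_le [CompleteSpace X] (hb : IsCoerciveForm κ b) {ι : Type*}
    (l : Ultrafilter ι) {f : ι → X} {R : ℝ} (hf : ∀ᶠ i in l, formNorm b (f i) ≤ R) :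
    ∃ y, ∀ v, Tendsto (fun i => b (f i) v) l (𝓝 (b y v)) := by
  have hbounded : ∀ᶠ i in l, StrongDual.toWeakDual (b (f i)) ∈
      WeakDual.toStrongDual ⁻¹' Metric.closedBall (0 : StrongDual ℝ X) (R * κ) := by
    filter_upwards [hf] with i hi
    have hR := (formNorm_nonneg b (f i)).trans hi
    have hκ := hb.pos.le
    refine mem_closedBall_zero_iff.2 ((b (f i)).opNorm_le_bound (by positivity) fun v => ?_)
    calc |b (f i) v| ≤ formNorm b (f i) * formNorm b v := hb.abs_apply_le _ _
      _ ≤ R * (κ * ‖v‖) := by gcongr; exacts [formNorm_nonneg _ _, hb.le_norm v]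
      _ = R * κ * ‖v‖ := (mul_assoc _ _ _).symm
  have hcompact := WeakDual.isCompact_closedBall (0 : StrongDual ℝ X) (R * κ)
  obtain ⟨ψ, -, hψ⟩ := hcompact.ultrafilter_le_nhds
    (l.map fun i => StrongDual.toWeakDual (b (f i))) (le_principal_iff.2 hbounded)
  obtain ⟨y, hy⟩ := hb.exists_apply_eq (WeakDual.toStrongDual ψ)
  exact ⟨y, fun v => hy v ▸ ((WeakDual.eval_continuous v).tendsto ψ).comp hψ⟩

lemma formNorm_le_of_tendsto_apply (hb : IsCoerciveForm κ b) {ι : Type*} {l : Filter ι} [l.NeBot]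
    {f : ι → X} {m : ι → ℝ} {y : X} {μ : ℝ}
    (hf : ∀ v, Tendsto (fun i => b (f i) v) l (𝓝 (b y v))) (hm : ∀ᶠ i in l, formNorm b (f i) ≤ m i)
    (hμ : Tendsto m l (𝓝 μ)) : formNorm b y ≤ μ := by
  rcases (formNorm_nonneg b y).eq_or_lt with hy | hy
  · rw [← hy]
    exact ge_of_tendsto hμ (hm.mono fun i hi => (formNorm_nonneg _ _).trans hi)
  · have hle : b y y ≤ μ * formNorm b y :=
      le_of_tendsto_of_tendsto (hf y) (hμ.mul_const _) (hm.mono fun i hi =>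
        (hb.apply_le _ _).trans (mul_le_mul_of_nonneg_right hi hy.le))
    rw [← hb.sq_formNorm, sq] at hle
    exact le_of_mul_le_mul_right hle hy

lemma tendsto_of_tendsto_apply (hb : IsCoerciveForm κ b) {ι : Type*} {l : Filter ι}
    {f : ι → X} {m : ι → ℝ} {y : X}
    (hf : ∀ v, Tendsto (fun i => b (f i) v) l (𝓝 (b y v))) (hm : ∀ᶠ i in l, formNorm b (f i) ≤ m i)
    (hμ : Tendsto m l (𝓝 (formNorm b y))) : Tendsto f l (𝓝 y) := by
  have hbound : Tendsto (fun i => κ ^ 2 * (m i ^ 2 - 2 * b (f i) y + b y y)) l (𝓝 0) := by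
    have := (((hμ.pow 2).sub ((hf y).const_mul 2)).add_const (b y y)).const_mul (κ ^ 2)
    rw [hb.sq_formNorm] at this
    convert this using 2
    ring
  have hsq : Tendsto (fun i => ‖f i - y‖ ^ 2) l (𝓝 0) := by
    refine squeeze_zero' (Eventually.of_forall fun _ => sq_nonneg _) ?_ hbound
    filter_upwards [hm] with i hi
    refine (hb.sq_norm_le _).trans (mul_le_mul_of_nonneg_left ?_ (sq_nonneg κ))
    have := pow_le_pow_left₀ (formNorm_nonneg _ _) hi 2
    rw [hb.sq_formNorm] at this
    simp only [map_sub, sub_apply, hb.symm y (f i)]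
    linarith
  simpa [tendsto_iff_norm_sub_tendsto_zero, Real.sqrt_sq] using hsq.sqrt

end IsCoerciveForm

/-- The form `b ⊕ b` on `X × X`. -/
noncomputable def prodForm (b : X →L[ℝ] X →L[ℝ] ℝ) : X × X →L[ℝ] X × X →L[ℝ] ℝ :=
  b.bilinearComp (.fst ℝ X X) (.fst ℝ X X) + b.bilinearComp (.snd ℝ X X) (.snd ℝ X X)

@[simp]
lemma prodForm_apply (b : X →L[ℝ] X →L[ℝ] ℝ) (p q : X × X) :
    prodForm b p q = b p.1 q.1 + b p.2 q.2 := rfl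

lemma IsCoerciveForm.prod {κ : ℝ} {b : X →L[ℝ] X →L[ℝ] ℝ} (hb : IsCoerciveForm κ b) :
    IsCoerciveForm (2 * κ) (prodForm b) where
  pos := by linarith [hb.pos]
  symm p q := by simp only [prodForm_apply, hb.symm p.1, hb.symm p.2]
  nonneg p := add_nonneg (hb.nonneg _) (hb.nonneg _)
  norm_le p := by
    have hfst : formNorm b p.1 ≤ formNorm (prodForm b) p :=
      Real.sqrt_le_sqrt (le_add_of_nonneg_right (hb.nonneg _))
    have hsnd : formNorm b p.2 ≤ formNorm (prodForm b) p :=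
      Real.sqrt_le_sqrt (le_add_of_nonneg_left (hb.nonneg _))
    have hpos := hb.pos
    have hnonneg := formNorm_nonneg (prodForm b) p
    have hκ : κ * formNorm (prodForm b) p ≤ 2 * κ * formNorm (prodForm b) p := by
      gcongr; linarith
    exact max_le
      ((hb.norm_le _).trans ((mul_le_mul_of_nonneg_left hfst hpos.le).trans hκ))
      ((hb.norm_le _).trans ((mul_le_mul_of_nonneg_left hsnd hpos.le).trans hκ))
  le_norm p := by
    have hpos := hb.pos
    have hfst := (hb.le_norm p.1).trans (mul_le_mul_of_nonneg_left (norm_fst_le p) hpos.le)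
    have hsnd := (hb.le_norm p.2).trans (mul_le_mul_of_nonneg_left (norm_snd_le p) hpos.le)
    refine Real.sqrt_le_iff.2 ⟨by positivity, ?_⟩
    have hfst := pow_le_pow_left₀ (formNorm_nonneg _ _) hfst 2
    have hsnd := pow_le_pow_left₀ (formNorm_nonneg _ _) hsnd 2
    rw [hb.sq_formNorm] at hfst hsnd
    rw [prodForm_apply]
    nlinarith [sq_nonneg (κ * ‖p‖)]

/-- The single-valued operator `E` with domain `D` is maximal monotone for the form `b`; the
values of `E` outside `D` are irrelevant. -/
structure IsMaxMonotone (b : X →L[ℝ] X →L[ℝ] ℝ) (D : Set X) (E : X → X) : Prop where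
  mono : ∀ x ∈ D, ∀ y ∈ D, 0 ≤ b (E x - E y) (x - y)
  maximal : ∀ x y, (∀ z ∈ D, 0 ≤ b (y - E z) (x - z)) → x ∈ D ∧ E x = y

namespace IsMaxMonotone

variable {κ : ℝ} {b : X →L[ℝ] X →L[ℝ] ℝ} {D : Set X} {E : X → X}

lemma add_const (hE : IsMaxMonotone b D E) (e : X) : IsMaxMonotone b D (fun x => E x + e) where
  mono x hx y hy := by simpa only [add_sub_add_right_eq_sub] using hE.mono x hx y hy
  maximal x y hxy := by
    obtain ⟨hx, hEx⟩ := hE.maximal x (y - e) fun z hz => by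
      simpa only [sub_sub, add_comm e] using hxy z hz
    exact ⟨hx, by rw [hEx, sub_add_cancel]⟩

lemma smul (hE : IsMaxMonotone b D E) {r : ℝ} (hr : 0 < r) :
    IsMaxMonotone b D (fun x => r • E x) where
  mono x hx y hy := by
    rw [← smul_sub, map_smul, smul_apply]
    exact smul_nonneg hr.le (hE.mono x hx y hy)
  maximal x y hxy := by
    obtain ⟨hx, hEx⟩ := hE.maximal x (r⁻¹ • y) fun z hz => by
      rw [← inv_smul_smul₀ hr.ne' (E z), ← smul_sub, map_smul, smul_apply]
      exact smul_nonneg (inv_nonneg.2 hr.le) (hxy z hz)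
    exact ⟨hx, by rw [hEx, smul_inv_smul₀ hr.ne']⟩

/-- The epigraph of twice the Fitzpatrick function `(x, y) ↦ sup_a ((x, E a) + (a, y) - (a, E a))`
of the operator `E` with domain `D`. It lies above `2 (x, y)` and contains the points
`((a, E a), 2 (a, E a))`. -/
def fitzpatrickEpigraph (b : X →L[ℝ] X →L[ℝ] ℝ) (D : Set X) (E : X → X) : Set ((X × X) × ℝ) :=
  {p | ∀ a ∈ D, 2 * (b p.1.1 (E a) + b a p.1.2 - b a (E a)) ≤ p.2}

lemma two_mul_apply_le_of_mem (hb : IsCoerciveForm κ b) (hE : IsMaxMonotone b D E)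
    {p : (X × X) × ℝ} (hp : p ∈ fitzpatrickEpigraph b D E) : 2 * b p.1.1 p.1.2 ≤ p.2 := by
  by_contra! hlt
  obtain ⟨hx, hEx⟩ := hE.maximal p.1.1 p.1.2 fun z hz => by
    have := hp z hz
    simp only [map_sub, sub_apply, hb.symm p.1.2, hb.symm (E z)]
    linarith
  have := hp p.1.1 hx
  rw [hEx] at this
  linarith

lemma mem_fitzpatrickEpigraph (hb : IsCoerciveForm κ b) (hE : IsMaxMonotone b D E) {a : X}
    (ha : a ∈ D) : ((a, E a), 2 * b a (E a)) ∈ fitzpatrickEpigraph b D E := fun z hz => by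
  have := hE.mono a ha z hz
  simp only [map_sub, sub_apply, hb.symm (E a), hb.symm (E z)] at this
  linarith

lemma convex_fitzpatrickEpigraph (b : X →L[ℝ] X →L[ℝ] ℝ) (D : Set X) (E : X → X) :
    Convex ℝ (fitzpatrickEpigraph b D E) := by
  intro p hp q hq α β hα hβ hαβ a ha
  have hpa := mul_le_mul_of_nonneg_left (hp a ha) hα
  have hqa := mul_le_mul_of_nonneg_left (hq a ha) hβ
  obtain rfl : β = 1 - α := by linarith
  simp only [Prod.fst_add, Prod.snd_add, Prod.smul_fst, Prod.smul_snd, map_add, map_smul,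
    add_apply, smul_apply, smul_eq_mul]
  linarith

lemma isClosed_fitzpatrickEpigraph (b : X →L[ℝ] X →L[ℝ] ℝ) (D : Set X) (E : X → X) :
    IsClosed (fitzpatrickEpigraph b D E) := by
  simp only [fitzpatrickEpigraph, ofPred_forall]
  exact isClosed_biInter fun a _ => isClosed_le (by fun_prop) (by fun_prop)

/-- With `(x, y)` minimizing the Fitzpatrick function plus half the squared norm, the pair
`(-y, -x)` belongs to the graph by maximality, and then `x + y = 0`. -/
lemma exists_add_eq_zero [CompleteSpace X] (hb : IsCoerciveForm κ b)
    (hE : IsMaxMonotone b D E) (hD : D.Nonempty) : ∃ x ∈ D, x + E x = 0 := by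
  obtain ⟨⟨⟨x, y⟩, s⟩, hs, hvar⟩ := hb.prod.exists_forall_nonneg_of_convex
    (convex_fitzpatrickEpigraph b D E) (isClosed_fitzpatrickEpigraph b D E)
    (hD.elim fun a ha => ⟨_, mem_fitzpatrickEpigraph hb hE ha⟩) ⟨0, by
      rintro _ ⟨p, hp, rfl⟩
      have hle := two_mul_apply_le_of_mem hb hE hp
      have hsq := hb.nonneg (p.1.1 + p.1.2)
      simp only [map_add, add_apply, hb.symm p.1.2 p.1.1, prodForm_apply] at hsq ⊢
      linarith⟩
  have hxy : 2 * b x y ≤ s := two_mul_apply_le_of_mem hb hE hs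
  have hgraph : ∀ a ∈ D, b (x + y) (x + y) ≤ b (-x - E a) (-y - a) := fun a ha => by
    have := hvar _ (mem_fitzpatrickEpigraph hb hE ha)
    simp only [prodForm_apply, map_add, map_sub, map_neg, neg_apply,
      add_apply, sub_apply, hb.symm y x, hb.symm (E a)] at this ⊢
    linarith
  obtain ⟨hy, hEy⟩ := hE.maximal (-y) (-x) fun a ha => (hb.nonneg _).trans (hgraph a ha)
  have hzero := hgraph _ hy
  rw [hEy, sub_self, map_zero, zero_apply] at hzero
  refine ⟨-y, hy, ?_⟩
  rw [hEy, ← neg_add_rev, hb.eq_zero_of_apply_self_nonpos hzero, neg_zero]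

lemma exists_add_smul_eq [CompleteSpace X] (hb : IsCoerciveForm κ b)
    (hE : IsMaxMonotone b D E) (hD : D.Nonempty) {r : ℝ} (hr : 0 < r) (z : X) :
    ∃ x ∈ D, x + r • E x = z := by
  obtain ⟨x, hx, hx0⟩ := ((hE.smul hr).add_const (-z)).exists_add_eq_zero hb hD
  exact ⟨x, hx, by rwa [← add_assoc, add_neg_eq_zero] at hx0⟩

variable {ι : Type*} {l : Filter ι} {u : ι → X} {x : X} {R : ℝ}

lemma exists_mem_and_tendsto_apply [CompleteSpace X] (hb : IsCoerciveForm κ b)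
    (hE : IsMaxMonotone b D E) {g : Ultrafilter ι} (hu : Tendsto u g (𝓝 x))
    (hD : ∀ᶠ i in g, u i ∈ D) (hR : ∀ᶠ i in g, formNorm b (E (u i)) ≤ R) :
    x ∈ D ∧ ∀ v, Tendsto (fun i => b (E (u i)) v) g (𝓝 (b (E x) v)) := by
  obtain ⟨y, hy⟩ := hb.exists_tendsto_apply_of_formNorm_le g hR
  have hcross : Tendsto (fun i => b (E (u i)) (u i - x)) g (𝓝 0) := by
    have hux : Tendsto (fun i => R * (κ * ‖u i - x‖)) g (𝓝 0) := by
      simpa using (((hu.sub_const x).norm).const_mul κ).const_mul R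
    refine squeeze_zero_norm' ?_ hux
    filter_upwards [hR] with i hi
    refine (hb.abs_apply_le _ _).trans ?_
    gcongr
    exacts [formNorm_nonneg _ _, (formNorm_nonneg _ _).trans hi, hb.le_norm _]
  have hgraph : ∀ z ∈ D, 0 ≤ b (y - E z) (x - z) := fun z hz => by
    have hlim : Tendsto (fun i => b (E (u i) - E z) (u i - z)) g (𝓝 (b (y - E z) (x - z))) := by
      have := (hcross.add (hy (x - z))).sub (((b (E z)).continuous.tendsto _).comp (hu.sub_const z))
      simpa [← map_add] using this
    exact ge_of_tendsto hlim (hD.mono fun i hi => hE.mono _ hi z hz)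
  obtain ⟨hx, rfl⟩ := hE.maximal x y hgraph
  exact ⟨hx, hy⟩

lemma mem_and_tendsto_apply [CompleteSpace X] [l.NeBot] (hb : IsCoerciveForm κ b)
    (hE : IsMaxMonotone b D E) (hu : Tendsto u l (𝓝 x)) (hD : ∀ᶠ i in l, u i ∈ D)
    (hR : ∀ᶠ i in l, formNorm b (E (u i)) ≤ R) :
    x ∈ D ∧ ∀ v, Tendsto (fun i => b (E (u i)) v) l (𝓝 (b (E x) v)) := by
  have hultra (g : Ultrafilter ι) (hg : ↑g ≤ l) :=
    hE.exists_mem_and_tendsto_apply hb (hu.mono_left hg) (hD.filter_mono hg) (hR.filter_mono hg)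
  exact ⟨(hultra _ (Ultrafilter.of_le l)).1, fun v =>
    (tendsto_iff_ultrafilter _ _ _).2 fun g hg => (hultra g hg).2 v⟩

end IsMaxMonotone

end Forms

section Dini

variable {f : ℝ → ℝ} {a b : ℝ} {N : Set ℝ}

/-- Zygmund's argument: a value `y` strictly between `f a` and `f b` and outside the countable set
`f '' N` is taken at a last point, and that point is not in `N`. -/
lemma le_of_frequently_le (hab : a ≤ b) (hf : ContinuousOn f (Icc a b)) (hN : N.Countable)
    (hle : ∀ r ∈ Ico a b, r ∉ N → ∃ᶠ z in 𝓝[>] r, f z ≤ f r) : f b ≤ f a := by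
  by_contra! hlt
  obtain ⟨y, ⟨hay, hyb⟩, hyN⟩ : (Ioo (f a) (f b) ∩ (f '' N)ᶜ).Nonempty :=
    ((hN.image f).dense_compl ℝ).inter_open_nonempty _ isOpen_Ioo (nonempty_Ioo.2 hlt)
  obtain ⟨r, ⟨hr, hry : f r ≤ y⟩, hmax⟩ :=
    (isCompact_Icc.of_isClosed_subset (hf.preimage_isClosed_of_isClosed isClosed_Icc isClosed_Iic)
      inter_subset_left).exists_isGreatest ⟨a, ⟨le_rfl, hab⟩, hay.le⟩
  have hrb : r < b := hr.2.lt_of_ne fun h => (h ▸ hry).not_gt hyb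
  have hgt : ∀ᶠ z in 𝓝[>] r, y < f z := by
    filter_upwards [Ioo_mem_nhdsGT hrb] with z hz
    exact not_le.1 fun hzy => (hmax ⟨⟨hr.1.trans hz.1.le, hz.2.le⟩, hzy⟩).not_gt hz.1
  have hyr : f r = y := by
    have hright : Tendsto f (𝓝[>] r) (𝓝 (f r)) :=
      (hf r hr).tendsto.mono_left
        (nhdsWithin_le_of_mem (mem_of_superset (Ioo_mem_nhdsGT hrb)
          (Ioo_subset_Icc_self.trans (Icc_subset_Icc_left hr.1))))
    exact hry.antisymm (ge_of_tendsto hright (hgt.mono fun _ => le_of_lt))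
  obtain ⟨z, hzr, hz⟩ := ((hle r ⟨hr.1, hrb⟩ fun h => hyN ⟨r, h, hyr⟩).and_eventually hgt).exists
  exact (hzr.trans_eq hyr).not_gt hz

lemma sub_le_of_eventually_slope_le {E : ℝ} (hab : a ≤ b) (hf : ContinuousOn f (Icc a b))
    (hN : N.Countable) (hslope : ∀ r ∈ Ico a b, r ∉ N → ∀ η > 0,
      ∀ᶠ z in 𝓝[>] r, f z - f r ≤ (E + η) * (z - r)) : f b - f a ≤ E * (b - a) := by
  have hη : ∀ η > 0, f b - f a ≤ (E + η) * (b - a) := fun η hη => by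
    have := le_of_frequently_le (f := fun z => f z - (E + η) * z) hab
      (hf.sub (by fun_prop)) hN fun r hr hrN => by
        refine (Eventually.mono (hslope r hr hrN η hη) fun z hz => ?_).frequently
        linarith
    linarith
  have hlim : Tendsto (fun η => (E + η) * (b - a)) (𝓝[>] 0) (𝓝 ((E + 0) * (b - a))) :=
    ((by fun_prop : Continuous fun η => (E + η) * (b - a)).tendsto 0).mono_left nhdsWithin_le_nhds
  rw [add_zero] at hlim
  exact ge_of_tendsto hlim (eventually_mem_nhdsWithin.mono hη)

end Dini

section RightDerivative

variable {X : Type*} [NormedAddCommGroup X] [NormedSpace ℝ X]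

lemma norm_sub_sub_smul_le_of_deriv_right {u : ℝ → X} {x y η : ℝ} {v : X}
    (hu : ContinuousOn u (Icc x y))
    (hderiv : ∀ r ∈ Ico x y, ∃ u', HasDerivWithinAt u u' (Ici r) r ∧ ‖u' - v‖ ≤ η) (hxy : x ≤ y) :
    ‖u y - u x - (y - x) • v‖ ≤ η * (y - x) := by
  choose! u' hu' hle using hderiv
  have hbound := norm_image_sub_le_of_norm_deriv_right_le_segment (f := fun r => u r - r • v)
    (hu.sub (by fun_prop)) (fun r hr =>
      ((hu' r hr).sub ((hasDerivWithinAt_id r (Ici r)).smul_const v)).congr_deriv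
        (by rw [one_smul])) hle y ⟨hxy, le_rfl⟩
  rwa [show u y - y • v - (u x - x • v) = u y - u x - (y - x) • v by module] at hbound

lemma hasDerivWithinAt_of_deriv_right {u g : ℝ → X} {a b t : ℝ} (hu : ContinuousOn u (Icc a b))
    (hderiv : ∀ r ∈ Ico a b, HasDerivWithinAt u (g r) (Ici r) r) (ht : t ∈ Icc a b)
    (hg : ContinuousWithinAt g (Icc a b) t) : HasDerivWithinAt u (g t) (Icc a b) t := by
  rw [hasDerivWithinAt_iff_isLittleO, Asymptotics.isLittleO_iff]
  intro η hη
  obtain ⟨δ, hδ, hball⟩ := Metric.continuousWithinAt_iff.1 hg η hη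
  have hnear {x y : ℝ} (hx : x ∈ Icc a b) (hy : y ∈ Icc a b) (hxt : x ∈ Metric.ball t δ)
      (hyt : y ∈ Metric.ball t δ) (hxy : x ≤ y) :
      ‖u y - u x - (y - x) • g t‖ ≤ η * (y - x) := by
    refine norm_sub_sub_smul_le_of_deriv_right (hu.mono (Icc_subset_Icc hx.1 hy.2))
      (fun z hz => ⟨g z, hderiv z ⟨hx.1.trans hz.1, hz.2.trans_le hy.2⟩, ?_⟩) hxy
    rw [← dist_eq_norm]
    refine (hball ⟨hx.1.trans hz.1, hz.2.le.trans hy.2⟩ ?_).le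
    rw [Real.ball_eq_Ioo] at hxt hyt
    rw [← Metric.mem_ball, Real.ball_eq_Ioo]
    exact ⟨hxt.1.trans_le hz.1, hz.2.trans hyt.2⟩
  have htt := Metric.mem_ball_self (x := t) hδ
  filter_upwards [mem_nhdsWithin_of_mem_nhds (Metric.ball_mem_nhds t hδ), self_mem_nhdsWithin]
    with r hr hrI
  rcases le_total t r with htr | hrt
  · rw [Real.norm_of_nonneg (sub_nonneg.2 htr)]
    exact hnear ht hrI htt hr htr
  · rw [Real.norm_of_nonpos (sub_nonpos.2 hrt), neg_sub, ← norm_neg,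
      show -(u r - u t - (r - t) • g t) = u t - u r - (t - r) • g t by module]
    exact hnear hrI ht hr htt hrt

end RightDerivative

lemma countable_not_continuousWithinAt_of_le_exp_mul {f : ℝ → ℝ} {s : Set ℝ} {C : ℝ}
    (hf : ∀ x ∈ s, ∀ y ∈ s, x ≤ y → f y ≤ Real.exp (C * (y - x)) * f x) :
    {t ∈ s | ¬ContinuousWithinAt f s t}.Countable := by
  have hanti : AntitoneOn (fun t => Real.exp (-(C * t)) * f t) s := fun x hx y hy hxy => by
    calc Real.exp (-(C * y)) * f y ≤ Real.exp (-(C * y)) * (Real.exp (C * (y - x)) * f x) := by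
          gcongr
          exact hf x hx y hy hxy
      _ = Real.exp (-(C * x)) * f x := by
          rw [← mul_assoc, ← Real.exp_add]
          congr 2
          ring
  refine hanti.countable_not_continuousWithinAt.mono ?_
  rintro t ⟨hts, hft⟩
  refine ⟨hts, fun hcont => hft ?_⟩
  have hexp : ContinuousWithinAt (fun t => Real.exp (C * t)) s t := by fun_prop
  refine (hexp.mul hcont).congr (fun x _ => ?_) ?_ <;>
    simp only [Pi.mul_apply, ← mul_assoc, ← Real.exp_add, add_neg_cancel, Real.exp_zero, one_mul]

section EvolutionFamily

variable {X : Type*} [NormedAddCommGroup X] [NormedSpace ℝ X]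

/-- The size of `u` as a state at time `t`: the graph norm of `u` for the operator `A t` and the
form `B t`. The summand `1` is the inhomogeneous term of the Lipschitz condition on `A`. -/
noncomputable def stateSize (B : ℝ → X →L[ℝ] X →L[ℝ] ℝ) (A : ℝ → X → X) (t : ℝ) (u : X) : ℝ :=
  1 + formNorm (B t) u + formNorm (B t) (A t u)

lemma one_le_stateSize (B : ℝ → X →L[ℝ] X →L[ℝ] ℝ) (A : ℝ → X → X) (t : ℝ) (u : X) :
    1 ≤ stateSize B A t u := by
  unfold stateSize
  linarith [formNorm_nonneg (B t) u, formNorm_nonneg (B t) (A t u)]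

lemma formNorm_le_stateSize (B : ℝ → X →L[ℝ] X →L[ℝ] ℝ) (A : ℝ → X → X) (t : ℝ) (u : X) :
    formNorm (B t) u ≤ stateSize B A t u := by
  unfold stateSize
  linarith [formNorm_nonneg (B t) (A t u)]

lemma formNorm_apply_le_stateSize (B : ℝ → X →L[ℝ] X →L[ℝ] ℝ) (A : ℝ → X → X) (t : ℝ) (u : X) :
    formNorm (B t) (A t u) ≤ stateSize B A t u := by
  unfold stateSize
  linarith [formNorm_nonneg (B t) u]

/-- The operators `A t`, with common domain `D` and Lipschitz dependence on `t`, are such that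
`A t + ω` is maximal monotone for the form `B t`. The forms `B t` depend continuously on `t`, are
uniformly equivalent to the norm of `X`, and grow at most at the rate `2 c`. -/
structure IsEvolutionFamily (T c ω κ Λ : ℝ) (B : ℝ → X →L[ℝ] X →L[ℝ] ℝ) (D : Set X)
    (A : ℝ → X → X) : Prop where
  c_nonneg : 0 ≤ c
  omega_nonneg : 0 ≤ ω
  lip_nonneg : 0 ≤ Λ
  coercive : ∀ t ∈ Icc 0 T, IsCoerciveForm κ (B t)
  growth : ∀ s ∈ Icc 0 T, ∀ t ∈ Icc 0 T, s ≤ t → ∀ u,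
    B t u u ≤ Real.exp (2 * c * (t - s)) * B s u u
  cont : ContinuousOn B (Icc 0 T)
  maxMono : ∀ t ∈ Icc 0 T, IsMaxMonotone (B t) D (fun x => A t x + ω • x)
  lip : ∀ r ∈ Icc 0 T, ∀ s ∈ Icc 0 T, ∀ t ∈ Icc 0 T, ∀ u ∈ D,
    formNorm (B r) (A t u - A s u) ≤ Λ * |t - s| * stateSize B A s u

/-- The exponential rate at which the state size of a solution may grow: `2 ω` and `c` come from
the quasi-monotonicity and the growth of the forms, `Λ` from the time dependence of the operators,
and `1` from `‖u'‖ = ‖A u‖`. -/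
def stateRate (c ω Λ : ℝ) : ℝ := 1 + 2 * ω + c + Λ

namespace IsEvolutionFamily

variable {T c ω κ Λ : ℝ} {B : ℝ → X →L[ℝ] X →L[ℝ] ℝ} {D : Set X} {A : ℝ → X → X}

lemma stateRate_nonneg (h : IsEvolutionFamily T c ω κ Λ B D A) : 0 ≤ stateRate c ω Λ := by
  unfold stateRate
  linarith [h.c_nonneg, h.omega_nonneg, h.lip_nonneg]

lemma formNorm_growth (h : IsEvolutionFamily T c ω κ Λ B D A) {s t : ℝ} (hs : s ∈ Icc 0 T)
    (ht : t ∈ Icc 0 T) (hst : s ≤ t) (u : X) :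
    formNorm (B t) u ≤ Real.exp (c * (t - s)) * formNorm (B s) u :=
  formNorm_le_exp_mul (by rw [← mul_assoc]; exact h.growth s hs t ht hst u)

lemma quasi_monotone (h : IsEvolutionFamily T c ω κ Λ B D A) {t : ℝ} (ht : t ∈ Icc 0 T)
    {u v : X} (hu : u ∈ D) (hv : v ∈ D) :
    -(ω * B t (u - v) (u - v)) ≤ B t (A t u - A t v) (u - v) := by
  have hmono := (h.maxMono t ht).mono u hu v hv
  rw [add_sub_add_comm, ← smul_sub, map_add, add_apply, map_smul, smul_apply,
    smul_eq_mul] at hmono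
  linarith

lemma exists_euler_step [CompleteSpace X] (h : IsEvolutionFamily T c ω κ Λ B D A)
    (hD : D.Nonempty) {t δ : ℝ} (ht : t ∈ Icc 0 T) (hδ : 0 < δ) (hδω : δ * ω < 1) (y : X) :
    ∃ z ∈ D, z + δ • A t z = y := by
  have hpos : 0 < 1 - δ * ω := by linarith
  obtain ⟨z, hz, hzy⟩ := (h.maxMono t ht).exists_add_smul_eq (h.coercive t ht) hD
    (div_pos hδ hpos) ((1 - δ * ω)⁻¹ • y)
  refine ⟨z, hz, ?_⟩
  rw [← smul_right_injective X hpos.ne' |>.eq_iff] at hzy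
  simp only [smul_add, smul_smul, mul_inv_cancel₀ hpos.ne', mul_div_cancel₀ _ hpos.ne', ← mul_assoc,
    one_smul] at hzy
  rw [← hzy]
  module

section EulerStep

variable {s t : ℝ} {y z : X}

lemma one_sub_mul_formNorm_apply_le (h : IsEvolutionFamily T c ω κ Λ B D A) (ht : t ∈ Icc 0 T)
    {δ : ℝ} (hδ : 0 < δ) (hy : y ∈ D) (hz : z ∈ D) (hzy : z + δ • A t z = y) :
    (1 - δ * ω) * formNorm (B t) (A t z) ≤ formNorm (B t) (A t y) := by
  have hb := h.coercive t ht
  have hmono := h.quasi_monotone ht hz hy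
  rw [show z - y = -(δ • A t z) by rw [← hzy]; abel] at hmono
  simp only [map_neg, map_smul, neg_apply, smul_apply, smul_eq_mul, map_sub, sub_apply] at hmono
  have hle : (1 - δ * ω) * B t (A t z) (A t z) ≤ B t (A t y) (A t z) :=
    le_of_mul_le_mul_left (by linarith) hδ
  have hCS := hb.apply_le (A t y) (A t z)
  rw [← hb.sq_formNorm] at hle
  rcases (formNorm_nonneg (B t) (A t z)).eq_or_lt with hzero | hpos
  · rw [← hzero, mul_zero]
    exact formNorm_nonneg _ _
  · exact le_of_mul_le_mul_right (by linarith) hpos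

lemma formNorm_apply_le_exp_mul_add (h : IsEvolutionFamily T c ω κ Λ B D A) (hs : s ∈ Icc 0 T)
    (ht : t ∈ Icc 0 T) (hst : s ≤ t) (hy : y ∈ D) :
    formNorm (B t) (A t y) ≤
      Real.exp (c * (t - s)) * formNorm (B s) (A s y) + Λ * (t - s) * stateSize B A s y := by
  have htriangle := (h.coercive t ht).formNorm_add_le (A s y) (A t y - A s y)
  rw [add_sub_cancel] at htriangle
  have hlip := h.lip t ht s hs t ht y hy
  rw [abs_of_nonneg (sub_nonneg.2 hst)] at hlip
  linarith [h.formNorm_growth hs ht hst (A s y)]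

lemma formNorm_le_exp_mul_add (h : IsEvolutionFamily T c ω κ Λ B D A) (hs : s ∈ Icc 0 T)
    (ht : t ∈ Icc 0 T) (hst : s ≤ t) {v : X} (hzy : z + (t - s) • v = y) :
    formNorm (B t) z ≤ Real.exp (c * (t - s)) * formNorm (B s) y + (t - s) * formNorm (B t) v := by
  have htriangle := (h.coercive t ht).formNorm_sub_le y ((t - s) • v)
  rw [formNorm_smul _ (sub_nonneg.2 hst), ← hzy, add_sub_cancel_right, hzy] at htriangle
  linarith [h.formNorm_growth hs ht hst y]

lemma stateRate_exp_le (h : IsEvolutionFamily T c ω κ Λ B D A) {δ : ℝ} (hδ : 0 ≤ δ) :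
    (1 + δ) * (1 + 2 * ω * δ) * (Real.exp (c * δ) + Λ * δ) ≤ Real.exp (stateRate c ω Λ * δ) := by
  have hω := mul_nonneg h.omega_nonneg hδ
  have hΛ := mul_nonneg h.lip_nonneg hδ
  have hone (x : ℝ) : 1 + x ≤ Real.exp x := by linarith [Real.add_one_le_exp x]
  have hc : Real.exp (c * δ) + Λ * δ ≤ Real.exp (c * δ) * Real.exp (Λ * δ) := by
    have hexp := Real.one_le_exp (mul_nonneg h.c_nonneg hδ)
    nlinarith [hone (Λ * δ)]
  calc (1 + δ) * (1 + 2 * ω * δ) * (Real.exp (c * δ) + Λ * δ)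
      ≤ Real.exp δ * Real.exp (2 * ω * δ) * (Real.exp (c * δ) * Real.exp (Λ * δ)) := by
        gcongr
        exacts [by linarith, hone δ, hone (2 * ω * δ)]
    _ = Real.exp (stateRate c ω Λ * δ) := by
        rw [← Real.exp_add, ← Real.exp_add, ← Real.exp_add]
        congr 1
        unfold stateRate
        ring

lemma stateSize_euler_step_le (h : IsEvolutionFamily T c ω κ Λ B D A) (hs : s ∈ Icc 0 T)
    (ht : t ∈ Icc 0 T) (hst : s < t) (hω : (t - s) * ω ≤ 1 / 2) (hy : y ∈ D) (hz : z ∈ D)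
    (hzy : z + (t - s) • A t z = y) :
    stateSize B A t z ≤ Real.exp (stateRate c ω Λ * (t - s)) * stateSize B A s y := by
  have hresolvent := h.one_sub_mul_formNorm_apply_le ht (sub_pos.2 hst) hy hz hzy
  have htransport := h.formNorm_apply_le_exp_mul_add hs ht hst.le hy
  have hnorm := h.formNorm_le_exp_mul_add hs ht hst.le hzy
  have hrate := h.stateRate_exp_le (sub_nonneg.2 hst.le)
  have hexp := Real.one_le_exp (mul_nonneg h.c_nonneg (sub_nonneg.2 hst.le))
  have hΦ := one_le_stateSize B A s y
  have hω0 := h.omega_nonneg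
  have := h.lip_nonneg
  set δ := t - s
  have hδ : 0 < δ := sub_pos.2 hst
  set Φ := stateSize B A s y with hΦ_def
  have happly : formNorm (B t) (A t z) ≤
      (1 + 2 * ω * δ) * (Real.exp (c * δ) * formNorm (B s) (A s y) + Λ * δ * Φ) := by
    have hinv : 1 ≤ (1 + 2 * ω * δ) * (1 - δ * ω) := by
      nlinarith [mul_nonneg (mul_nonneg hω0 hδ.le) (sub_nonneg.2 hω)]
    calc formNorm (B t) (A t z)
        ≤ (1 + 2 * ω * δ) * (1 - δ * ω) * formNorm (B t) (A t z) :=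
          le_mul_of_one_le_left (formNorm_nonneg _ _) hinv
      _ ≤ (1 + 2 * ω * δ) * (Real.exp (c * δ) * formNorm (B s) (A s y) + Λ * δ * Φ) := by
          rw [mul_assoc]
          exact mul_le_mul_of_nonneg_left (hresolvent.trans htransport) (by positivity)
  have hone : 1 ≤ (1 + δ) * (1 + 2 * ω * δ) :=
    one_le_mul_of_one_le_of_one_le (by linarith) (by linarith [mul_nonneg hω0 hδ.le])
  calc stateSize B A t z
      ≤ Real.exp (c * δ) * (1 + formNorm (B s) y) + (1 + δ) * formNorm (B t) (A t z) := by
        unfold stateSize; linarith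
    _ ≤ (1 + δ) * (1 + 2 * ω * δ) * (Real.exp (c * δ) * (1 + formNorm (B s) y)) + (1 + δ) *
        ((1 + 2 * ω * δ) * (Real.exp (c * δ) * formNorm (B s) (A s y) + Λ * δ * Φ)) := by
        refine add_le_add (le_mul_of_one_le_left (mul_nonneg (Real.exp_nonneg _) ?_) hone)
          (mul_le_mul_of_nonneg_left happly (by linarith))
        linarith [formNorm_nonneg (B s) y]
    _ = (1 + δ) * (1 + 2 * ω * δ) * (Real.exp (c * δ) + Λ * δ) * Φ := by
        rw [hΦ_def]; unfold stateSize; ring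
    _ ≤ Real.exp (stateRate c ω Λ * δ) * Φ := by gcongr

end EulerStep

section Limits

variable {ι : Type*} {l : Filter ι} {τ : ι → ℝ} {p : ι → X} {m : ι → ℝ} {t M : ℝ} {x : X}

lemma tendsto_apply_sub_apply (h : IsEvolutionFamily T c ω κ Λ B D A) (ht : t ∈ Icc 0 T)
    (hτ : Tendsto τ l (𝓝[Icc 0 T] t))
    (hpm : ∀ᶠ i in l, p i ∈ D ∧ stateSize B A (τ i) (p i) ≤ m i) (hM : Tendsto m l (𝓝 M)) :
    Tendsto (fun i => A t (p i) - A (τ i) (p i)) l (𝓝 0) := by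
  obtain ⟨hτt, hτT⟩ := tendsto_nhdsWithin_iff.1 hτ
  have hb := h.coercive t ht
  have hlim : Tendsto (fun i => κ * (Λ * |t - τ i| * m i)) l (𝓝 0) := by
    simpa using (((hτt.const_sub t).abs.const_mul Λ).mul hM).const_mul κ
  refine squeeze_zero_norm' ?_ hlim
  filter_upwards [hτT, hpm] with i hi ⟨hpD, hmi⟩
  have hcoeff : 0 ≤ Λ * |t - τ i| := mul_nonneg h.lip_nonneg (abs_nonneg _)
  exact (hb.norm_le _).trans (mul_le_mul_of_nonneg_left ((h.lip t ht _ hi t ht _ hpD).trans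
    (mul_le_mul_of_nonneg_left hmi hcoeff)) hb.pos.le)

lemma exists_formNorm_apply_le (h : IsEvolutionFamily T c ω κ Λ B D A) (ht : t ∈ Icc 0 T)
    (hτ : Tendsto τ l (𝓝[Icc 0 T] t)) (hp : Tendsto p l (𝓝 x))
    (hm : ∀ᶠ i in l, stateSize B A (τ i) (p i) ≤ m i) (hM : Tendsto m l (𝓝 M)) :
    ∃ m' : ι → ℝ, (∀ᶠ i in l, formNorm (B t) (A (τ i) (p i)) ≤ m' i) ∧
      Tendsto m' l (𝓝 (M - 1 - formNorm (B t) x)) := by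
  have hBτ : Tendsto (fun i => B (τ i)) l (𝓝 (B t)) := (h.cont t ht).tendsto.comp hτ
  have hsqrt : Tendsto (fun i => √‖B t - B (τ i)‖) l (𝓝 0) := by
    simpa [norm_sub_rev (B t)] using (tendsto_iff_norm_sub_tendsto_zero.1 hBτ).sqrt
  refine ⟨fun i => m i - 1 - formNorm (B (τ i)) (p i) + √‖B t - B (τ i)‖ * (κ * m i), ?_, by
    simpa using ((hM.sub_const 1).sub (tendsto_formNorm hBτ hp)).add
      (hsqrt.mul (hM.const_mul κ))⟩
  filter_upwards [(tendsto_nhdsWithin_iff.1 hτ).2, hm] with i hi hmi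
  have hb := h.coercive _ hi
  have hnorm : ‖A (τ i) (p i)‖ ≤ κ * m i := (hb.norm_le _).trans
    (mul_le_mul_of_nonneg_left ((formNorm_apply_le_stateSize B A _ _).trans hmi) hb.pos.le)
  refine (formNorm_le_add_sqrt (B (τ i)) (B t) _).trans (add_le_add ?_ ?_)
  · unfold stateSize at hmi
    linarith
  · exact mul_le_mul_of_nonneg_left hnorm (Real.sqrt_nonneg _)

lemma mem_and_tendsto_form_apply [l.NeBot] [CompleteSpace X]
    (h : IsEvolutionFamily T c ω κ Λ B D A) (ht : t ∈ Icc 0 T) (hτ : Tendsto τ l (𝓝[Icc 0 T] t))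
    (hp : Tendsto p l (𝓝 x)) (hpm : ∀ᶠ i in l, p i ∈ D ∧ stateSize B A (τ i) (p i) ≤ m i)
    (hM : Tendsto m l (𝓝 M)) :
    x ∈ D ∧ ∀ v, Tendsto (fun i => B t (A (τ i) (p i)) v) l (𝓝 (B t (A t x) v)) := by
  have hb := h.coercive t ht
  obtain ⟨m', hm', hM'⟩ := h.exists_formNorm_apply_le ht hτ hp (hpm.mono fun _ hi => hi.2) hM
  have hdiff : Tendsto (fun i => A t (p i) - A (τ i) (p i) + ω • p i) l (𝓝 (0 + ω • x)) :=
    (h.tendsto_apply_sub_apply ht hτ hpm hM).add (hp.const_smul ω)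
  have hbound := hM'.add (tendsto_formNorm (tendsto_const_nhds (x := B t)) hdiff)
  obtain ⟨hx, hweak⟩ := (h.maxMono t ht).mem_and_tendsto_apply hb hp (hpm.mono fun _ hi => hi.1) (by
    filter_upwards [hm', hbound.eventually_le_const (lt_add_one _)] with i hmi hle
    rw [show A t (p i) + ω • p i = A (τ i) (p i) + (A t (p i) - A (τ i) (p i) + ω • p i) by abel]
    exact (hb.formNorm_add_le _ _).trans ((add_le_add_left hmi _).trans hle))
  refine ⟨hx, fun v => ?_⟩
  have hlim := (hweak v).sub (((B t).flip v).continuous.tendsto _ |>.comp hdiff)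
  refine (hlim.congr fun i => ?_).trans (le_of_eq ?_)
  · simp only [Function.comp_apply, ContinuousLinearMap.flip_apply, map_add, map_sub, add_apply]
    ring
  · simp only [zero_add, ContinuousLinearMap.flip_apply, map_add, add_apply, add_sub_cancel_right]

lemma mem_and_stateSize_le [l.NeBot] [CompleteSpace X] (h : IsEvolutionFamily T c ω κ Λ B D A)
    (ht : t ∈ Icc 0 T) (hτ : Tendsto τ l (𝓝[Icc 0 T] t)) (hp : Tendsto p l (𝓝 x))
    (hpm : ∀ᶠ i in l, p i ∈ D ∧ stateSize B A (τ i) (p i) ≤ m i) (hM : Tendsto m l (𝓝 M)) :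
    x ∈ D ∧ stateSize B A t x ≤ M := by
  obtain ⟨m', hm', hM'⟩ := h.exists_formNorm_apply_le ht hτ hp (hpm.mono fun _ hi => hi.2) hM
  obtain ⟨hx, hweak⟩ := h.mem_and_tendsto_form_apply ht hτ hp hpm hM
  refine ⟨hx, ?_⟩
  unfold stateSize
  linarith [(h.coercive t ht).formNorm_le_of_tendsto_apply hweak hm' hM']

lemma tendsto_apply [l.NeBot] [CompleteSpace X] (h : IsEvolutionFamily T c ω κ Λ B D A)
    (ht : t ∈ Icc 0 T) (hτ : Tendsto τ l (𝓝[Icc 0 T] t)) (hp : Tendsto p l (𝓝 x))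
    (hpm : ∀ᶠ i in l, p i ∈ D ∧ stateSize B A (τ i) (p i) ≤ m i)
    (hM : Tendsto m l (𝓝 (stateSize B A t x))) :
    Tendsto (fun i => A (τ i) (p i)) l (𝓝 (A t x)) := by
  obtain ⟨m', hm', hM'⟩ := h.exists_formNorm_apply_le ht hτ hp (hpm.mono fun _ hi => hi.2) hM
  refine (h.coercive t ht).tendsto_of_tendsto_apply
    (h.mem_and_tendsto_form_apply ht hτ hp hpm hM).2 hm' ?_
  convert hM' using 2
  unfold stateSize
  ring

end Limits

section Growth

variable {d : ℝ → X} {s r E : ℝ}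

lemma eventually_exp_mul_sub_le (h : IsEvolutionFamily T c ω κ Λ B D A) {d' : X}
    (hs : 0 ≤ s) (hsr : s ≤ r) (hrT : r < T) (hd : HasDerivWithinAt d d' (Ici r) r) (hE : 0 ≤ E)
    (hle : B r (d r) d' ≤ ω * B r (d r) (d r) + E) {η : ℝ} (hη : 0 < η) :
    ∀ᶠ z in 𝓝[>] r, Real.exp (-(2 * (c + ω) * (z - s))) * B z (d z) (d z)
      - Real.exp (-(2 * (c + ω) * (r - s))) * B r (d r) (d r) ≤ (2 * E + η) * (z - r) := by
  have hr : r ∈ Icc 0 T := ⟨hs.trans hsr, hrT.le⟩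
  -- With the form frozen at time `r`, the decay in `z` has to come from `ω` alone.
  set ψ : ℝ → ℝ := fun z => Real.exp (-(2 * ω * (z - s)) - 2 * c * (r - s)) with hψ
  have hψ' : HasDerivWithinAt ψ (ψ r * -(2 * ω)) (Ioi r) r := by
    have hlin := (((hasDerivAt_id r).sub_const s).const_mul (2 * ω)).neg
    simpa using (hlin.sub_const (2 * c * (r - s))).exp.hasDerivWithinAt
  have hψr : ψ r ≤ 1 := by
    rw [hψ, Real.exp_le_one_iff]
    have := mul_nonneg (add_nonneg h.omega_nonneg h.c_nonneg) (sub_nonneg.2 hsr)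
    linarith
  have hslope : ψ r * -(2 * ω) * B r (d r) (d r) + ψ r * (2 * B r (d r) d') < 2 * E + η := by
    have := mul_le_mul_of_nonneg_left hle (Real.exp_nonneg (-(2 * ω * (r - s)) - 2 * c * (r - s)))
    linarith [mul_le_mul_of_nonneg_right hψr hE]
  have hprod := hψ'.mul ((h.coercive r hr).hasDerivWithinAt_apply_self
    (hd.mono Ioi_subset_Ici_self))
  filter_upwards [hprod.limsup_slope_le' self_notMem_Ioi hslope, Ioo_mem_nhdsGT hrT]
    with z hz ⟨hrz, hzT⟩
  rw [slope_def_field, div_lt_iff₀ (sub_pos.2 hrz)] at hz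
  refine le_trans (sub_le_sub ?_ (le_of_eq ?_)) hz.le
  · calc Real.exp (-(2 * (c + ω) * (z - s))) * B z (d z) (d z)
        ≤ Real.exp (-(2 * (c + ω) * (z - s))) *
            (Real.exp (2 * c * (z - r)) * B r (d z) (d z)) := by
          gcongr
          exact h.growth r hr z ⟨hr.1.trans hrz.le, hzT.le⟩ hrz.le (d z)
      _ = ψ z * B r (d z) (d z) := by
          rw [← mul_assoc, ← Real.exp_add]
          congr 2
          ring
  · simp only [Pi.mul_apply, hψ]
    congr 2
    ring

lemma apply_self_le_exp_mul (h : IsEvolutionFamily T c ω κ Λ B D A) (hs : 0 ≤ s) (hsr : s ≤ r)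
    (hrT : r ≤ T) (hd : ContinuousOn d (Icc s r)) (hE : 0 ≤ E) {N : Set ℝ} (hN : N.Countable)
    (hderiv : ∀ z ∈ Ico s r, z ∉ N → ∃ d', HasDerivWithinAt d d' (Ici z) z ∧
      B z (d z) d' ≤ ω * B z (d z) (d z) + E) :
    B r (d r) (d r) ≤
      Real.exp (2 * (c + ω) * (r - s)) * (B s (d s) (d s) + 2 * E * (r - s)) := by
  have hcont : ContinuousOn (fun z => Real.exp (-(2 * (c + ω) * (z - s))) * B z (d z) (d z))
      (Icc s r) := by
    refine ContinuousOn.mul (by fun_prop) fun z hz => tendsto_form_apply ?_ (hd z hz) (hd z hz)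
    exact h.cont.mono (Icc_subset_Icc hs hrT) z hz
  have hgrowth := sub_le_of_eventually_slope_le hsr hcont hN fun z hz hzN η hη => by
    obtain ⟨d', hd', hle⟩ := hderiv z hz hzN
    exact h.eventually_exp_mul_sub_le hs hz.1 (hz.2.trans_le hrT) hd' hE hle hη
  rw [sub_self, mul_zero, neg_zero, Real.exp_zero, one_mul, sub_le_iff_le_add', Real.exp_neg,
    inv_mul_le_iff₀ (Real.exp_pos _)] at hgrowth
  exact hgrowth

end Growth

end IsEvolutionFamily

/-- The pair `(τ, p)` approximates `(r, w)` within `ε`, from the right in time, and `p` is a state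
of size at most `P` at time `τ`. -/
structure IsNearbyState (B : ℝ → X →L[ℝ] X →L[ℝ] ℝ) (D : Set X) (A : ℝ → X → X)
    (T ε P r : ℝ) (w : X) (τ : ℝ) (p : X) : Prop where
  time_mem : τ ∈ Icc r T
  time_le : τ ≤ r + ε
  mem : p ∈ D
  dist_le : ‖w - p‖ ≤ ε
  size_le : stateSize B A τ p ≤ P

/-- Approximate solutions of `w' + A(t) w = 0` on `[s, t]`: at every time `r` the right derivative
of `w` is `-A τ p` for some `(τ, p)` close to `(r, w r)`. The state sizes are at most
`M * exp (C * time)`. -/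
structure IsApproxSolution (C : ℝ) (B : ℝ → X →L[ℝ] X →L[ℝ] ℝ) (D : Set X) (A : ℝ → X → X)
    (ε M s t : ℝ) (w : ℝ → X) : Prop where
  continuousOn : ContinuousOn w (Icc s t)
  exists_deriv : ∀ r ∈ Ico s t, ∃ τ p,
    IsNearbyState B D A t ε (Real.exp (C * τ) * M) r (w r) τ p ∧
      HasDerivWithinAt w (-(A τ p)) (Ici r) r
  right_mem : w t ∈ D
  right_size_le : stateSize B A t (w t) ≤ Real.exp (C * t) * M

namespace IsApproxSolution

variable {C : ℝ} {B : ℝ → X →L[ℝ] X →L[ℝ] ℝ} {D : Set X} {A : ℝ → X → X} {ε M s t : ℝ}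
  {w : ℝ → X}

lemma restrict (h : IsApproxSolution C B D A ε M s t w) {s' : ℝ} (hs : s ≤ s') :
    IsApproxSolution C B D A ε M s' t w :=
  ⟨h.continuousOn.mono (Icc_subset_Icc_left hs),
    fun r hr => h.exists_deriv r ⟨hs.trans hr.1, hr.2⟩, h.right_mem, h.right_size_le⟩

lemma mono_bound (h : IsApproxSolution C B D A ε M s t w) {M' : ℝ} (hM : M ≤ M') :
    IsApproxSolution C B D A ε M' s t w := by
  have hexp (τ : ℝ) : Real.exp (C * τ) * M ≤ Real.exp (C * τ) * M' := by gcongr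
  refine ⟨h.continuousOn, fun r hr => ?_, h.right_mem, h.right_size_le.trans (hexp t)⟩
  obtain ⟨τ, p, hp, hderiv⟩ := h.exists_deriv r hr
  exact ⟨τ, p, { hp with size_le := hp.size_le.trans (hexp τ) }, hderiv⟩

lemma const {x : X} (hx : x ∈ D) (hM : stateSize B A s x ≤ Real.exp (C * s) * M) :
    IsApproxSolution C B D A ε M s s (fun _ => x) :=
  ⟨continuousOn_const, fun _ hr => absurd hr (by simp), hx, hM⟩

lemma concat {t' : ℝ} {w' : ℝ → X} (hst : s ≤ t) (htt' : t ≤ t')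
    (h : IsApproxSolution C B D A ε M s t w) (h' : IsApproxSolution C B D A ε M t t' w')
    (hw : w t = w' t) : ∃ w'', IsApproxSolution C B D A ε M s t' w'' ∧ w'' s = w s := by
  set w'' : ℝ → X := fun r => if r < t then w r else w' r with hw''
  have hleft : EqOn w'' w (Icc s t) := fun r hr => by
    rcases hr.2.eq_or_lt with rfl | hlt
    · simp [hw'', hw]
    · simp [hw'', hlt]
  have hright : EqOn w'' w' (Ici t) := fun r hr => by simp [hw'', not_lt.2 (mem_Ici.1 hr)]
  refine ⟨w'', ⟨?_, fun r hr => ?_, ?_, ?_⟩, hleft ⟨le_rfl, hst⟩⟩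
  · rw [← Icc_union_Icc_eq_Icc hst htt']
    exact (h.continuousOn.congr hleft).union_of_isClosed
      (h'.continuousOn.congr (hright.mono Icc_subset_Ici_self)) isClosed_Icc isClosed_Icc
  · rcases lt_or_ge r t with hrt | hrt
    · obtain ⟨τ, p, hp, hderiv⟩ := h.exists_deriv r ⟨hr.1, hrt⟩
      rw [hleft ⟨hr.1, hrt.le⟩]
      refine ⟨τ, p, { hp with time_mem := ⟨hp.time_mem.1, hp.time_mem.2.trans htt'⟩ },
        hderiv.congr_of_eventuallyEq ?_ (hleft ⟨hr.1, hrt.le⟩)⟩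
      filter_upwards [Ico_mem_nhdsGE hrt] with z hz
      exact hleft ⟨hr.1.trans hz.1, hz.2.le⟩
    · obtain ⟨τ, p, hp, hderiv⟩ := h'.exists_deriv r ⟨hrt, hr.2⟩
      rw [hright hrt]
      exact ⟨τ, p, hp, hderiv.congr (fun z hz => hright (hrt.trans hz)) (hright hrt)⟩
  · rw [hright htt']
    exact h'.right_mem
  · rw [hright htt']
    exact h'.right_size_le

lemma exists_isNearbyState (h : IsApproxSolution C B D A ε M s t w) (hε : 0 ≤ ε) {r : ℝ}
    (hr : r ∈ Icc s t) : ∃ τ p, IsNearbyState B D A t ε (Real.exp (C * τ) * M) r (w r) τ p := by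
  rcases hr.2.eq_or_lt with rfl | hrt
  · exact ⟨r, w r, ⟨le_rfl, le_rfl⟩, by linarith, h.right_mem, by simpa using hε, h.right_size_le⟩
  · obtain ⟨τ, p, hp, -⟩ := h.exists_deriv r ⟨hr.1, hrt⟩
    exact ⟨τ, p, hp⟩

end IsApproxSolution

/-- `u` is the limit as `ε → 0` of the approximate solutions on `[s, T]` that start at `u s`; this
is expressed by an estimate of the distance to approximate solutions with any initial value. -/
def IsApproxLimit (C : ℝ) (B : ℝ → X →L[ℝ] X →L[ℝ] ℝ) (D : Set X) (A : ℝ → X → X)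
    (T M E : ℝ) (u : ℝ → X) : Prop :=
  ∀ s ∈ Icc 0 T, ∀ ε, 0 ≤ ε → ∀ w, IsApproxSolution C B D A ε M s T w →
    ∀ r ∈ Icc s T, ‖w r - u r‖ ^ 2 ≤ E * (‖w s - u s‖ ^ 2 + ε)

namespace IsEvolutionFamily

variable {T c ω κ Λ : ℝ} {B : ℝ → X →L[ℝ] X →L[ℝ] ℝ} {D : Set X} {A : ℝ → X → X}

section Existence

variable {s ε M : ℝ} {x : X}

/-- `w` is the affine interpolation of one implicit Euler step. -/
lemma exists_approxSolution_step [CompleteSpace X] (h : IsEvolutionFamily T c ω κ Λ B D A)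
    {t t' : ℝ} (ht : t ∈ Icc 0 T) (ht' : t' ∈ Icc 0 T) (htt' : t < t') {y : X} (hy : y ∈ D)
    (hM : stateSize B A t y ≤ Real.exp (stateRate c ω Λ * t) * M)
    (hω : (t' - t) * ω ≤ 1 / 2) (hε : t' - t ≤ ε)
    (hκε : (t' - t) * (κ * (Real.exp (stateRate c ω Λ * t') * M)) ≤ ε) :
    ∃ w, IsApproxSolution (stateRate c ω Λ) B D A ε M t t' w ∧ w t = y := by
  obtain ⟨z, hz, hzy⟩ := h.exists_euler_step ⟨y, hy⟩ ht' (sub_pos.2 htt') (by linarith) y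
  have hb := h.coercive t' ht'
  have hzM : stateSize B A t' z ≤ Real.exp (stateRate c ω Λ * t') * M :=
    calc stateSize B A t' z
        ≤ Real.exp (stateRate c ω Λ * (t' - t)) * (Real.exp (stateRate c ω Λ * t) * M) :=
          (h.stateSize_euler_step_le ht ht' htt' hω hy hz hzy).trans (by gcongr)
      _ = Real.exp (stateRate c ω Λ * t') * M := by
          rw [← mul_assoc, ← Real.exp_add]
          ring_nf
  have hAz : ‖A t' z‖ ≤ κ * (Real.exp (stateRate c ω Λ * t') * M) := (hb.norm_le _).trans
    (mul_le_mul_of_nonneg_left ((formNorm_apply_le_stateSize B A t' z).trans hzM) hb.pos.le)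
  have hwt' : y - (t' - t) • A t' z = z := by rw [← hzy, add_sub_cancel_right]
  refine ⟨fun r => y - (r - t) • A t' z, ⟨by fun_prop, fun r hr => ⟨t', z, ?_, ?_⟩, by
    rwa [hwt'], by rwa [hwt']⟩, by simp⟩
  · refine ⟨⟨hr.2.le, le_rfl⟩, by linarith [hr.1], hz, ?_, hzM⟩
    rw [show y - (r - t) • A t' z - z = (t' - r) • A t' z by rw [← hzy]; module, norm_smul,
      Real.norm_of_nonneg (sub_nonneg.2 hr.2.le)]
    exact (mul_le_mul (by linarith [hr.1]) hAz (norm_nonneg _) (by linarith)).trans hκε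
  · simpa using
      (((hasDerivWithinAt_id r (Ici r)).sub_const t).smul_const (A t' z)).const_sub y

lemma exists_approxSolution_of_step [CompleteSpace X] (h : IsEvolutionFamily T c ω κ Λ B D A)
    (hs : s ∈ Icc 0 T) (hx : x ∈ D)
    (hM : stateSize B A s x ≤ Real.exp (stateRate c ω Λ * s) * M) (hM₀ : 0 ≤ M) {δ : ℝ}
    (hδ : 0 < δ) (hω : δ * ω ≤ 1 / 2) (hε : δ ≤ ε)
    (hκε : δ * (κ * (Real.exp (stateRate c ω Λ * T) * M)) ≤ ε) (k : ℕ) (hk : s + k * δ ≤ T) :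
    ∃ w, IsApproxSolution (stateRate c ω Λ) B D A ε M s (s + k * δ) w ∧ w s = x := by
  induction k with
  | zero => exact ⟨fun _ => x, by simpa using .const hx hM, rfl⟩
  | succ k ih =>
    have hstep : s + (k + 1 : ℕ) * δ - (s + k * δ) = δ := by push_cast; ring
    have hk₀ : 0 ≤ k * δ := by positivity
    obtain ⟨w, hw, hws⟩ := ih (by linarith)
    obtain ⟨w', hw', hww'⟩ := h.exists_approxSolution_step (t := s + k * δ) (ε := ε)
      ⟨by linarith [hs.1], by linarith⟩ ⟨by linarith [hs.1], hk⟩ (by linarith) hw.right_mem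
      hw.right_size_le (by rwa [hstep]) (by rwa [hstep]) (by
        rw [hstep]
        refine le_trans ?_ hκε
        gcongr
        exacts [(h.coercive s hs).pos.le, h.stateRate_nonneg])
    obtain ⟨w'', hw'', hw''s⟩ := hw.concat (by linarith) (by linarith) hw' hww'.symm
    exact ⟨w'', hw'', hw''s.trans hws⟩

lemma exists_approxSolution [CompleteSpace X] (h : IsEvolutionFamily T c ω κ Λ B D A)
    (hs : s ∈ Icc 0 T) (hε : 0 < ε) (hx : x ∈ D)
    (hM : stateSize B A s x ≤ Real.exp (stateRate c ω Λ * s) * M) :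
    ∃ w, IsApproxSolution (stateRate c ω Λ) B D A ε M s T w ∧ w s = x := by
  rcases hs.2.eq_or_lt with rfl | hsT
  · exact ⟨_, .const hx hM, rfl⟩
  have hM₀ : 0 < M := pos_of_mul_pos_right
    (zero_lt_one.trans_le ((one_le_stateSize B A s x).trans hM)) (Real.exp_nonneg _)
  have hmesh : Tendsto (fun n : ℕ => (T - s) / (n + 1 : ℕ)) atTop (𝓝 0) :=
    (tendsto_const_div_atTop_nhds_zero_nat (T - s)).comp (tendsto_add_atTop_nat 1)
  have hsmall {η : ℝ} (K : ℝ) (hη : 0 < η) : ∀ᶠ n : ℕ in atTop, (T - s) / (n + 1 : ℕ) * K ≤ η :=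
    (hmesh.mul_const K).eventually_le_const (by rwa [zero_mul])
  obtain ⟨n, hnω, hnε, hnκ⟩ := ((hsmall ω one_half_pos).and ((hsmall 1 hε).and
    (hsmall (κ * (Real.exp (stateRate c ω Λ * T) * M)) hε))).exists
  have hend : s + (n + 1 : ℕ) * ((T - s) / (n + 1 : ℕ)) = T := by
    rw [mul_div_cancel₀ _ (by positivity), add_sub_cancel]
  simpa only [hend] using h.exists_approxSolution_of_step hs hx hM hM₀.le
    (div_pos (sub_pos.2 hsT) (by positivity)) hnω (by rwa [mul_one] at hnε) hnκ (n + 1) hend.le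

end Existence

section Comparison

variable {ε M s r : ℝ}

lemma formNorm_le_of_isNearbyState (h : IsEvolutionFamily T c ω κ Λ B D A) {P τ : ℝ} {w p v : X}
    (hr : r ∈ Icc 0 T) (hp : IsNearbyState B D A T ε P r w τ p)
    (hv : formNorm (B τ) v ≤ stateSize B A τ p) : formNorm (B r) v ≤ κ ^ 2 * P :=
  ((h.coercive τ ⟨hr.1.trans hp.time_mem.1, hp.time_mem.2⟩).formNorm_le_sq_mul
    (h.coercive r hr) v).trans (mul_le_mul_of_nonneg_left (hv.trans hp.size_le) (sq_nonneg κ))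

lemma formNorm_apply_sub_le_of_isNearbyState (h : IsEvolutionFamily T c ω κ Λ B D A) {P τ : ℝ}
    {w p : X} (hr : r ∈ Icc 0 T) (hp : IsNearbyState B D A T ε P r w τ p) :
    formNorm (B r) (A r p - A τ p) ≤ Λ * ε * P := by
  have hdist : |r - τ| ≤ ε := by
    rw [abs_sub_comm, abs_of_nonneg (sub_nonneg.2 hp.time_mem.1)]
    linarith [hp.time_le]
  refine (h.lip r hr τ ⟨hr.1.trans hp.time_mem.1, hp.time_mem.2⟩ r hr p hp.mem).trans
    (mul_le_mul ?_ hp.size_le ?_ ?_)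
  · exact mul_le_mul_of_nonneg_left hdist h.lip_nonneg
  · exact zero_le_one.trans (one_le_stateSize B A τ p)
  · exact mul_nonneg h.lip_nonneg ((abs_nonneg _).trans hdist)

lemma apply_sub_le (h : IsEvolutionFamily T c ω κ Λ B D A) {P ε₁ ε₂ τ₁ τ₂ : ℝ}
    {w₁ w₂ p₁ p₂ : X} (hr : r ∈ Icc 0 T) (h₁ : IsNearbyState B D A T ε₁ P r w₁ τ₁ p₁)
    (h₂ : IsNearbyState B D A T ε₂ P r w₂ τ₂ p₂) :
    B r (w₁ - w₂) (-(A τ₁ p₁) - -(A τ₂ p₂)) ≤ ω * B r (w₁ - w₂) (w₁ - w₂)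
      + 2 * κ ^ 2 * P * (Λ * P + κ + 2 * ω * κ) * (ε₁ + ε₂) := by
  have hb := h.coercive r hr
  have hstates : formNorm (B r) (p₁ - p₂) ≤ 2 * (κ ^ 2 * P) := by
    linarith [hb.formNorm_sub_le p₁ p₂,
      h.formNorm_le_of_isNearbyState hr h₁ (formNorm_le_stateSize B A τ₁ p₁),
      h.formNorm_le_of_isNearbyState hr h₂ (formNorm_le_stateSize B A τ₂ p₂)]
  have hvalues : formNorm (B r) (A τ₁ p₁ - A τ₂ p₂) ≤ 2 * (κ ^ 2 * P) := by
    linarith [hb.formNorm_sub_le (A τ₁ p₁) (A τ₂ p₂),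
      h.formNorm_le_of_isNearbyState hr h₁ (formNorm_apply_le_stateSize B A τ₁ p₁),
      h.formNorm_le_of_isNearbyState hr h₂ (formNorm_apply_le_stateSize B A τ₂ p₂)]
  have hfreeze : formNorm (B r) (A r p₁ - A r p₂ - (A τ₁ p₁ - A τ₂ p₂)) ≤
      Λ * (ε₁ + ε₂) * P := by
    rw [sub_sub_sub_comm]
    linarith [hb.formNorm_sub_le (A r p₁ - A τ₁ p₁) (A r p₂ - A τ₂ p₂),
      h.formNorm_apply_sub_le_of_isNearbyState hr h₁,
      h.formNorm_apply_sub_le_of_isNearbyState hr h₂]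
  have herror : formNorm (B r) (w₁ - p₁ - (w₂ - p₂)) ≤ κ * (ε₁ + ε₂) :=
    (hb.le_norm _).trans (mul_le_mul_of_nonneg_left
      ((norm_sub_le _ _).trans (add_le_add h₁.dist_le h₂.dist_le)) hb.pos.le)
  have hmain := hb.apply_add_neg_le h.omega_nonneg (h.quasi_monotone hr h₁.mem h₂.mem) hstates
    hvalues hfreeze herror
  rw [show p₁ - p₂ + (w₁ - p₁ - (w₂ - p₂)) = w₁ - w₂ by abel] at hmain
  rw [neg_sub_neg, ← neg_sub (A τ₁ p₁)]
  linarith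

lemma apply_self_sub_le (h : IsEvolutionFamily T c ω κ Λ B D A) (hM : 0 ≤ M) {P ε₁ ε₂ : ℝ}
    (hP : Real.exp (stateRate c ω Λ * T) * M ≤ P) (hε : 0 ≤ ε₁ + ε₂) (hs : 0 ≤ s) {w₁ w₂ : ℝ → X}
    (hw₁ : IsApproxSolution (stateRate c ω Λ) B D A ε₁ M s T w₁)
    (hw₂ : IsApproxSolution (stateRate c ω Λ) B D A ε₂ M s T w₂) (hr : r ∈ Icc s T) :
    B r (w₁ r - w₂ r) (w₁ r - w₂ r) ≤
      Real.exp (2 * (c + ω) * (r - s)) * (B s (w₁ s - w₂ s) (w₁ s - w₂ s)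
        + 2 * (2 * κ ^ 2 * P * (Λ * P + κ + 2 * ω * κ) * (ε₁ + ε₂)) * (r - s)) := by
  have hκ := (h.coercive r ⟨hs.trans hr.1, hr.2⟩).pos
  have hP₀ : 0 ≤ P := (mul_nonneg (Real.exp_nonneg _) hM).trans hP
  have hF : 0 ≤ 2 * κ ^ 2 * P * (Λ * P + κ + 2 * ω * κ) := by
    have := h.lip_nonneg
    have := h.omega_nonneg
    positivity
  have hsize {τ : ℝ} (hτ : τ ≤ T) : Real.exp (stateRate c ω Λ * τ) * M ≤ P := by
    refine le_trans ?_ hP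
    gcongr
    exact h.stateRate_nonneg
  refine h.apply_self_le_exp_mul hs hr.1 hr.2 (d := fun z => w₁ z - w₂ z)
    ((hw₁.continuousOn.sub hw₂.continuousOn).mono (Icc_subset_Icc_right hr.2))
    (mul_nonneg hF hε) countable_empty fun z hz _ => ?_
  have hzT : z ∈ Ico s T := ⟨hz.1, hz.2.trans_le hr.2⟩
  obtain ⟨τ₁, p₁, hp₁, hderiv₁⟩ := hw₁.exists_deriv z hzT
  obtain ⟨τ₂, p₂, hp₂, hderiv₂⟩ := hw₂.exists_deriv z hzT
  exact ⟨_, hderiv₁.sub hderiv₂, h.apply_sub_le ⟨hs.trans hz.1, hzT.2.le⟩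
    { hp₁ with size_le := hp₁.size_le.trans (hsize hp₁.time_mem.2) }
    { hp₂ with size_le := hp₂.size_le.trans (hsize hp₂.time_mem.2) }⟩

lemma exists_sq_norm_sub_le (h : IsEvolutionFamily T c ω κ Λ B D A) (hM : 0 ≤ M) :
    ∃ E, ∀ ε₁ ε₂, 0 ≤ ε₁ + ε₂ → ∀ s, 0 ≤ s → ∀ w₁ w₂,
      IsApproxSolution (stateRate c ω Λ) B D A ε₁ M s T w₁ →
      IsApproxSolution (stateRate c ω Λ) B D A ε₂ M s T w₂ →
      ∀ r ∈ Icc s T, ‖w₁ r - w₂ r‖ ^ 2 ≤ E * (‖w₁ s - w₂ s‖ ^ 2 + (ε₁ + ε₂)) := by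
  obtain ⟨P, hP⟩ : ∃ P, Real.exp (stateRate c ω Λ * T) * M ≤ P := ⟨_, le_rfl⟩
  set F := 2 * κ ^ 2 * P * (Λ * P + κ + 2 * ω * κ)
  refine ⟨κ ^ 2 * (Real.exp (2 * (c + ω) * T) * (κ ^ 2 + 2 * F * T)),
    fun ε₁ ε₂ hε s hs w₁ w₂ hw₁ hw₂ r hr => ?_⟩
  have hsT : s ∈ Icc 0 T := ⟨hs, hr.1.trans hr.2⟩
  have hb := h.coercive s hsT
  have hT₀ : 0 ≤ T := hs.trans hsT.2
  have hP₀ : 0 ≤ P := (mul_nonneg (Real.exp_nonneg _) hM).trans hP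
  have hκ := hb.pos
  have hΛ := h.lip_nonneg
  have hω := h.omega_nonneg
  have hc := h.c_nonneg
  have : 0 ≤ F := by positivity
  have hinitial : B s (w₁ s - w₂ s) (w₁ s - w₂ s) ≤ κ ^ 2 * ‖w₁ s - w₂ s‖ ^ 2 := by
    rw [← hb.sq_formNorm, ← mul_pow]
    exact pow_le_pow_left₀ (formNorm_nonneg _ _) (hb.le_norm _) 2
  have hrs : r - s ≤ T := by linarith [hr.2]
  calc ‖w₁ r - w₂ r‖ ^ 2
      ≤ κ ^ 2 * (Real.exp (2 * (c + ω) * (r - s)) * (B s (w₁ s - w₂ s) (w₁ s - w₂ s)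
          + 2 * (F * (ε₁ + ε₂)) * (r - s))) :=
        ((h.coercive r ⟨hs.trans hr.1, hr.2⟩).sq_norm_le _).trans (mul_le_mul_of_nonneg_left
          (h.apply_self_sub_le hM hP hε hs hw₁ hw₂ hr) (sq_nonneg κ))
    _ ≤ κ ^ 2 * (Real.exp (2 * (c + ω) * T) * (κ ^ 2 * ‖w₁ s - w₂ s‖ ^ 2
          + 2 * (F * (ε₁ + ε₂)) * T)) := by
        have := hb.nonneg (w₁ s - w₂ s)
        have := sub_nonneg.2 hr.1
        gcongr
    _ ≤ κ ^ 2 * (Real.exp (2 * (c + ω) * T) * (κ ^ 2 + 2 * F * T)) *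
          (‖w₁ s - w₂ s‖ ^ 2 + (ε₁ + ε₂)) := by
        have hsq : 0 ≤ κ ^ 2 * (ε₁ + ε₂) := by positivity
        have hcross : 0 ≤ 2 * F * T * ‖w₁ s - w₂ s‖ ^ 2 := by positivity
        rw [mul_assoc (κ ^ 2), mul_assoc (Real.exp _)]
        refine mul_le_mul_of_nonneg_left (mul_le_mul_of_nonneg_left ?_ (Real.exp_nonneg _))
          (sq_nonneg κ)
        linarith

end Comparison

section Limit

variable {s r M M' E : ℝ} {u : ℝ → X} {x : X}

lemma exists_isApproxLimit [CompleteSpace X] (h : IsEvolutionFamily T c ω κ Λ B D A)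
    (hT : 0 ≤ T) (hx : x ∈ D) :
    ∃ E u, IsApproxLimit (stateRate c ω Λ) B D A T (stateSize B A 0 x) E u ∧ u 0 = x := by
  have hzero : (0 : ℝ) ∈ Icc 0 T := ⟨le_rfl, hT⟩
  have hε (n : ℕ) : (0 : ℝ) ≤ 1 / (n + 1) := Nat.one_div_pos_of_nat.le
  have hε_lim := tendsto_one_div_add_atTop_nhds_zero_nat (𝕜 := ℝ)
  obtain ⟨E, hE⟩ := h.exists_sq_norm_sub_le (zero_le_one.trans (one_le_stateSize B A 0 x))
  choose w hw hw₀ using fun n : ℕ => h.exists_approxSolution (M := stateSize B A 0 x) hzero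
    (Nat.one_div_pos_of_nat (α := ℝ) (n := n)) hx (by simp)
  have hlim : ∀ r ∈ Icc 0 T, ∃ y, Tendsto (fun n => w n r) atTop (𝓝 y) := fun r hr => by
    refine cauchySeq_tendsto_of_complete (cauchySeq_iff_tendsto_dist_atTop_0.2 ?_)
    have hbound : Tendsto (fun n : ℕ × ℕ => √(E * (1 / ((n.1 : ℝ) + 1) + 1 / ((n.2 : ℝ) + 1))))
        atTop (𝓝 0) := by
      rw [← prod_atTop_atTop_eq]
      simpa using (((hε_lim.comp tendsto_fst).add (hε_lim.comp tendsto_snd)).const_mul E).sqrt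
    refine squeeze_zero (fun n => dist_nonneg) (fun n => ?_) hbound
    rw [dist_eq_norm]
    refine Real.le_sqrt_of_sq_le ?_
    simpa [hw₀] using hE _ _ (add_nonneg (hε n.1) (hε n.2)) 0 le_rfl _ _ (hw n.1) (hw n.2) r hr
  choose! u hu using hlim
  refine ⟨E, u, fun s hs ε hε₀ v hv r hr => ?_, tendsto_nhds_unique (hu 0 hzero) (by simp [hw₀])⟩
  have hright : Tendsto (fun n : ℕ => E * (‖v s - w n s‖ ^ 2 + (ε + 1 / ((n : ℝ) + 1)))) atTop
      (𝓝 (E * (‖v s - u s‖ ^ 2 + (ε + 0)))) :=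
    ((((hu s hs).const_sub (v s)).norm.pow 2).add (hε_lim.const_add ε)).const_mul E
  rw [add_zero] at hright
  exact le_of_tendsto_of_tendsto'
    (((hu r ⟨hs.1.trans hr.1, hr.2⟩).const_sub (v r)).norm.pow 2) hright fun n =>
      hE _ _ (add_nonneg hε₀ (hε n)) s hs.1 _ _ hv ((hw n).restrict hs.1) r hr

lemma exists_approxSolution_tendsto [CompleteSpace X] (h : IsEvolutionFamily T c ω κ Λ B D A)
    (hu : IsApproxLimit (stateRate c ω Λ) B D A T M E u) (hs : s ∈ Icc 0 T) (hus : u s ∈ D)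
    (hM' : stateSize B A s (u s) ≤ Real.exp (stateRate c ω Λ * s) * M') (hM : M' ≤ M) :
    ∃ w : ℕ → ℝ → X,
      (∀ n : ℕ, IsApproxSolution (stateRate c ω Λ) B D A (1 / ((n : ℝ) + 1)) M' s T (w n) ∧
        w n s = u s) ∧ ∀ r ∈ Icc s T, Tendsto (fun n => w n r) atTop (𝓝 (u r)) := by
  choose w hw using fun n : ℕ => h.exists_approxSolution hs
    (Nat.one_div_pos_of_nat (α := ℝ) (n := n)) hus hM'
  refine ⟨w, hw, fun r hr => tendsto_iff_norm_sub_tendsto_zero.2 ?_⟩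
  have hbound : Tendsto (fun n : ℕ => √(E * (1 / ((n : ℝ) + 1)))) atTop (𝓝 0) := by
    simpa using ((tendsto_one_div_add_atTop_nhds_zero_nat (𝕜 := ℝ)).const_mul E).sqrt
  refine squeeze_zero (fun n => norm_nonneg _) (fun n => Real.le_sqrt_of_sq_le ?_) hbound
  simpa [(hw n).2] using
    hu s hs _ Nat.one_div_pos_of_nat.le _ ((hw n).1.mono_bound hM) r hr

lemma mem_and_stateSize_le_of_isApproxLimit [CompleteSpace X]
    (h : IsEvolutionFamily T c ω κ Λ B D A)
    (hu : IsApproxLimit (stateRate c ω Λ) B D A T M E u) (hs : s ∈ Icc 0 T) (hus : u s ∈ D)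
    (hM' : stateSize B A s (u s) ≤ Real.exp (stateRate c ω Λ * s) * M') (hM : M' ≤ M)
    (hr : r ∈ Icc s T) :
    u r ∈ D ∧ stateSize B A r (u r) ≤ Real.exp (stateRate c ω Λ * r) * M' := by
  obtain ⟨w, hw, hlim⟩ := h.exists_approxSolution_tendsto hu hs hus hM' hM
  have hε_lim := tendsto_one_div_add_atTop_nhds_zero_nat (𝕜 := ℝ)
  choose τ p hp using fun n : ℕ => (hw n).1.exists_isNearbyState Nat.one_div_pos_of_nat.le hr
  have hτ : Tendsto τ atTop (𝓝 r) :=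
    tendsto_of_tendsto_of_tendsto_of_le_of_le tendsto_const_nhds
      (by simpa using hε_lim.const_add r) (fun n => (hp n).time_mem.1) fun n => (hp n).time_le
  have hpu : Tendsto p atTop (𝓝 (u r)) := by
    simpa using (hlim r hr).sub (squeeze_zero_norm (fun n => (hp n).dist_le) hε_lim)
  exact h.mem_and_stateSize_le ⟨hs.1.trans hr.1, hr.2⟩
    (tendsto_nhdsWithin_iff.2 ⟨hτ, Eventually.of_forall fun n =>
      ⟨hs.1.trans (hr.1.trans (hp n).time_mem.1), (hp n).time_mem.2⟩⟩) hpu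
    (Eventually.of_forall fun n => ⟨(hp n).mem, (hp n).size_le⟩)
    ((hτ.const_mul (stateRate c ω Λ)).rexp.mul_const M')

lemma stateSize_le_exp_mul_of_isApproxLimit [CompleteSpace X]
    (h : IsEvolutionFamily T c ω κ Λ B D A)
    (hu : IsApproxLimit (stateRate c ω Λ) B D A T M E u) (hs : s ∈ Icc 0 T) (hus : u s ∈ D)
    (hM : stateSize B A s (u s) ≤ Real.exp (stateRate c ω Λ * s) * M) (hr : r ∈ Icc s T) :
    stateSize B A r (u r) ≤ Real.exp (stateRate c ω Λ * (r - s)) * stateSize B A s (u s) := by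
  have hexp := Real.exp_pos (stateRate c ω Λ * s)
  have hM' := mul_div_cancel₀ (stateSize B A s (u s)) hexp.ne'
  refine (h.mem_and_stateSize_le_of_isApproxLimit hu hs hus hM'.ge
    ((div_le_iff₀' hexp).2 hM) hr).2.trans_eq ?_
  rw [mul_sub, Real.exp_sub]
  ring

lemma norm_approxSolution_sub_le (h : IsEvolutionFamily T c ω κ Λ B D A) {ε : ℝ} {w : ℝ → X}
    (hs : 0 ≤ s) (hM : 0 ≤ M) (hw : IsApproxSolution (stateRate c ω Λ) B D A ε M s T w)
    (hr : r ∈ Icc s T) :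
    ‖w r - w s‖ ≤ κ * (Real.exp (stateRate c ω Λ * T) * M) * (r - s) := by
  have hbound := norm_sub_sub_smul_le_of_deriv_right (v := 0)
    (η := κ * (Real.exp (stateRate c ω Λ * T) * M))
    (hw.continuousOn.mono (Icc_subset_Icc_right hr.2)) (fun z hz => ?_) hr.1
  · simpa using hbound
  obtain ⟨τ, p, hp, hderiv⟩ := hw.exists_deriv z ⟨hz.1, hz.2.trans_le hr.2⟩
  have hb := h.coercive τ ⟨hs.trans (hz.1.trans hp.time_mem.1), hp.time_mem.2⟩
  refine ⟨_, hderiv, ?_⟩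
  rw [sub_zero, norm_neg]
  refine (hb.norm_le _).trans (mul_le_mul_of_nonneg_left ?_ hb.pos.le)
  refine (formNorm_apply_le_stateSize B A τ p).trans (hp.size_le.trans ?_)
  have := h.stateRate_nonneg
  have := hp.time_mem.2
  gcongr

lemma norm_sub_le_of_isApproxLimit [CompleteSpace X] (h : IsEvolutionFamily T c ω κ Λ B D A)
    (hu : IsApproxLimit (stateRate c ω Λ) B D A T M E u) (hM₀ : 0 ≤ M) (hs : s ∈ Icc 0 T)
    (hus : u s ∈ D) (hM : stateSize B A s (u s) ≤ Real.exp (stateRate c ω Λ * s) * M)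
    (hr : r ∈ Icc s T) :
    ‖u r - u s‖ ≤ κ * (Real.exp (stateRate c ω Λ * T) * M) * (r - s) := by
  obtain ⟨w, hw, hlim⟩ := h.exists_approxSolution_tendsto hu hs hus hM le_rfl
  refine le_of_tendsto' ((hlim r hr).sub_const (u s)).norm fun n => ?_
  rw [← (hw n).2]
  exact h.norm_approxSolution_sub_le hs.1 hM₀ (hw n).1 hr

/-- Along states whose size is at most the limiting one, weak convergence of the values `A τ p`
improves to strong convergence. -/
lemma continuousWithinAt_apply [CompleteSpace X] (h : IsEvolutionFamily T c ω κ Λ B D A)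
    (hs : s ∈ Icc 0 T) (hx : x ∈ D) (C : ℝ) :
    ContinuousWithinAt (fun q : ℝ × X => A q.1 q.2)
      {q | q.1 ∈ Icc 0 T ∧ q.2 ∈ D ∧
        stateSize B A q.1 q.2 ≤ Real.exp (C * (q.1 - s)) * stateSize B A s x} (s, x) := by
  set S : Set (ℝ × X) := {q | q.1 ∈ Icc 0 T ∧ q.2 ∈ D ∧
    stateSize B A q.1 q.2 ≤ Real.exp (C * (q.1 - s)) * stateSize B A s x}
  have : (𝓝[S] (s, x)).NeBot :=
    mem_closure_iff_nhdsWithin_neBot.1 (subset_closure ⟨hs, hx, by simp⟩)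
  have hS : ∀ᶠ q in 𝓝[S] (s, x), q ∈ S := eventually_mem_nhdsWithin
  have hfst : Tendsto Prod.fst (𝓝[S] (s, x)) (𝓝 s) := continuousWithinAt_fst
  refine h.tendsto_apply hs (tendsto_nhdsWithin_iff.2 ⟨hfst, hS.mono fun q hq => hq.1⟩)
    continuousWithinAt_snd (hS.mono fun q hq => hq.2) ?_
  simpa using ((hfst.sub_const s).const_mul C).rexp.mul_const (stateSize B A s x)

lemma exists_norm_approxSolution_sub_sub_smul_le [CompleteSpace X]
    (h : IsEvolutionFamily T c ω κ Λ B D A) (hs : s ∈ Icc 0 T) (hx : x ∈ D)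
    (hM : Real.exp (stateRate c ω Λ * s) * M = stateSize B A s x) {η : ℝ} (hη : 0 < η) :
    ∃ ρ > 0, ∀ ε ≤ ρ, ∀ w, IsApproxSolution (stateRate c ω Λ) B D A ε M s T w → w s = x →
      ∀ r ∈ Icc s T, r ≤ s + ρ → ‖w r - x - (r - s) • -A s x‖ ≤ η * (r - s) := by
  obtain ⟨δ, hδ, hball⟩ := Metric.continuousWithinAt_iff.1
    (h.continuousWithinAt_apply hs hx (stateRate c ω Λ)) η hη
  have hM₀ : 0 ≤ M := (pos_of_mul_pos_right
    (zero_lt_one.trans_le ((one_le_stateSize B A s x).trans hM.ge)) (Real.exp_nonneg _)).le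
  set K := κ * (Real.exp (stateRate c ω Λ * T) * M)
  have hK : 0 ≤ K := mul_nonneg (h.coercive s hs).pos.le (by positivity)
  obtain ⟨ρ, hρ, hρδ⟩ := exists_pos_mul_lt hδ (2 + K)
  refine ⟨ρ, hρ, fun ε hε w hw hws r hr hrρ => ?_⟩
  rw [← hws]
  refine norm_sub_sub_smul_le_of_deriv_right
    (hw.continuousOn.mono (Icc_subset_Icc_right hr.2)) (fun z hz => ?_) hr.1
  have hzT : z ∈ Ico s T := ⟨hz.1, hz.2.trans_le hr.2⟩
  obtain ⟨τ, p, hp, hderiv⟩ := hw.exists_deriv z hzT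
  have hzρ : z - s ≤ ρ := by linarith [hz.2]
  refine ⟨_, hderiv, ?_⟩
  rw [neg_sub_neg, norm_sub_rev, hws, ← dist_eq_norm]
  refine (hball (x := (τ, p)) ⟨⟨hs.1.trans (hz.1.trans hp.time_mem.1), hp.time_mem.2⟩, hp.mem,
    ?_⟩ (max_lt ?_ ?_)).le
  · refine hp.size_le.trans_eq ?_
    rw [← hM, ← mul_assoc, ← Real.exp_add]
    ring_nf
  · rw [Real.dist_eq, abs_of_nonneg (by linarith [hp.time_mem.1, hz.1])]
    linarith [hp.time_le, mul_nonneg hK hρ.le]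
  · rw [dist_comm, dist_eq_norm, ← hws]
    calc ‖w s - p‖ = ‖(w z - p) - (w z - w s)‖ := by rw [sub_sub_sub_cancel_left]
      _ ≤ ‖w z - p‖ + ‖w z - w s‖ := norm_sub_le _ _
      _ ≤ ε + K * (z - s) :=
        add_le_add hp.dist_le (h.norm_approxSolution_sub_le hs.1 hM₀ hw ⟨hz.1, hzT.2.le⟩)
      _ < δ := by linarith [mul_le_mul_of_nonneg_left hzρ hK]

lemma hasDerivWithinAt_Ici_of_isApproxLimit [CompleteSpace X]
    (h : IsEvolutionFamily T c ω κ Λ B D A)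
    (hu : IsApproxLimit (stateRate c ω Λ) B D A T M E u) (hs : s ∈ Ico 0 T) (hus : u s ∈ D)
    (hM : stateSize B A s (u s) ≤ Real.exp (stateRate c ω Λ * s) * M) :
    HasDerivWithinAt u (-A s (u s)) (Ici s) s := by
  have hsT : s ∈ Icc 0 T := Ico_subset_Icc_self hs
  have hexp := Real.exp_pos (stateRate c ω Λ * s)
  have hM' := mul_div_cancel₀ (stateSize B A s (u s)) hexp.ne'
  obtain ⟨w, hw, hlim⟩ := h.exists_approxSolution_tendsto hu hsT hus hM'.ge
    ((div_le_iff₀' hexp).2 hM)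
  rw [hasDerivWithinAt_iff_isLittleO, Asymptotics.isLittleO_iff]
  intro η hη
  obtain ⟨ρ, hρ, hbound⟩ := h.exists_norm_approxSolution_sub_sub_smul_le hsT hus hM' hη
  filter_upwards [Ico_mem_nhdsGE (lt_min hs.2 (lt_add_of_pos_right s hρ))] with r hr
  obtain ⟨hrT, hrρ⟩ := le_min_iff.1 hr.2.le
  rw [Real.norm_of_nonneg (sub_nonneg.2 hr.1)]
  refine le_of_tendsto (((hlim r ⟨hr.1, hrT⟩).sub_const (u s)).sub_const _).norm ?_
  filter_upwards [tendsto_one_div_add_atTop_nhds_zero_nat.eventually_le_const hρ] with n hn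
  exact hbound _ hn _ (hw n).1 (hw n).2 r ⟨hr.1, hrT⟩ hrρ

end Limit

section WellPosedness

variable {a : X} {u v : ℝ → X}

/-- Divided by an exponential, the state size of the limit is monotone, so it is continuous off a
countable set; where it is continuous, so is `t ↦ A t (u t)`. -/
lemma exists_solution [CompleteSpace X] (h : IsEvolutionFamily T c ω κ Λ B D A) (hT : 0 ≤ T)
    (ha : a ∈ D) : ∃ u : ℝ → X, u 0 = a ∧ (∀ t ∈ Icc 0 T, u t ∈ D) ∧
      (∃ K, LipschitzOnWith K u (Icc 0 T)) ∧
      ∃ N : Set ℝ, N.Countable ∧ ∀ t ∈ Icc 0 T \ N,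
        HasDerivWithinAt u (-A t (u t)) (Icc 0 T) t ∧
          ContinuousWithinAt (fun s => -A s (u s)) (Icc 0 T) t := by
  obtain ⟨E, u, hu, rfl⟩ := h.exists_isApproxLimit hT ha
  have hzero : (0 : ℝ) ∈ Icc 0 T := ⟨le_rfl, hT⟩
  have hsize (t : ℝ) (ht : t ∈ Icc 0 T) := h.mem_and_stateSize_le_of_isApproxLimit hu hzero ha
    (by simp) le_rfl ht
  have hM₀ := zero_le_one.trans (one_le_stateSize B A 0 (u 0))
  have hK : 0 ≤ κ * (Real.exp (stateRate c ω Λ * T) * stateSize B A 0 (u 0)) :=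
    mul_nonneg (h.coercive 0 hzero).pos.le (mul_nonneg (Real.exp_nonneg _) hM₀)
  have hlip : LipschitzOnWith ⟨_, hK⟩ u (Icc 0 T) := by
    refine LipschitzOnWith.of_dist_le_mul fun r hr s hs => ?_
    wlog hsr : s ≤ r generalizing r s
    · rw [dist_comm (u r), dist_comm r]
      exact this s hs r hr (le_of_not_ge hsr)
    rw [dist_eq_norm, Real.dist_eq, abs_of_nonneg (sub_nonneg.2 hsr)]
    exact h.norm_sub_le_of_isApproxLimit hu hM₀ hs (hsize s hs).1 (hsize s hs).2 ⟨hsr, hr.2⟩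
  refine ⟨u, rfl, fun t ht => (hsize t ht).1, ⟨_, hlip⟩, _,
    countable_not_continuousWithinAt_of_le_exp_mul fun s hs r hr hsr =>
      h.stateSize_le_exp_mul_of_isApproxLimit hu hs (hsize s hs).1 (hsize s hs).2 ⟨hsr, hr.2⟩, ?_⟩
  rintro t ⟨ht, htN⟩
  have hcont : ContinuousWithinAt (fun s => stateSize B A s (u s)) (Icc 0 T) t :=
    not_not.1 fun hcont => htN ⟨ht, hcont⟩
  have : (𝓝[Icc 0 T] t).NeBot := mem_closure_iff_nhdsWithin_neBot.1 (subset_closure ht)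
  have hA : ContinuousWithinAt (fun s => -A s (u s)) (Icc 0 T) t :=
    (h.tendsto_apply ht tendsto_id (hlip.continuousOn t ht)
      (eventually_mem_nhdsWithin.mono fun s hs => ⟨(hsize s hs).1, le_rfl⟩) hcont).neg
  refine ⟨hasDerivWithinAt_of_deriv_right hlip.continuousOn (fun r hr => ?_) ht hA, hA⟩
  have hrT := hsize r (Ico_subset_Icc_self hr)
  exact h.hasDerivWithinAt_Ici_of_isApproxLimit hu hr hrT.1 hrT.2

lemma eqOn_of_isCauchySolution (h : IsEvolutionFamily T c ω κ Λ B D A)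
    (hu : IsCauchySolution T D A a u) (hv : IsCauchySolution T D A a v) :
    EqOn v u (Icc 0 T) := by
  intro r hr
  obtain ⟨N, hN, hNu⟩ := hu.equation
  obtain ⟨N', hN', hNv⟩ := hv.equation
  have hgrowth := h.apply_self_le_exp_mul (d := fun z => v z - u z) le_rfl hr.1 hr.2
    ((hv.continuousOn.sub hu.continuousOn).mono (Icc_subset_Icc_right hr.2)) le_rfl
    (hN.union hN') fun z hz hzN => by
      rw [mem_union, not_or] at hzN
      have hzT : z ∈ Icc 0 T := ⟨hz.1, hz.2.le.trans hr.2⟩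
      have hmem : Icc 0 T ∈ 𝓝[≥] z := Icc_mem_nhdsGE_of_mem ⟨hz.1, hz.2.trans_le hr.2⟩
      refine ⟨_, ((hNv z ⟨hzT, hzN.2⟩).mono_of_mem_nhdsWithin hmem).sub
        ((hNu z ⟨hzT, hzN.1⟩).mono_of_mem_nhdsWithin hmem), ?_⟩
      have hmono := h.quasi_monotone hzT (hv.mem_domain z hzT) (hu.mem_domain z hzT)
      rw [(h.coercive z hzT).symm (A z (v z) - A z (u z))] at hmono
      rw [← neg_sub', map_neg]
      linarith
  simp only [hu.initial, hv.initial, sub_self, map_zero, mul_zero, zero_mul, add_zero] at hgrowth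
  exact sub_eq_zero.1 ((h.coercive r hr).eq_zero_of_apply_self_nonpos hgrowth)

end WellPosedness

end IsEvolutionFamily

theorem mainTheorem4_general {X : Type*} [NormedAddCommGroup X] [NormedSpace ℝ X] [CompleteSpace X]
    {T c ω κ Λ : ℝ} (hT : 0 ≤ T) {B : ℝ → X →L[ℝ] X →L[ℝ] ℝ} {D : Set X} {A : ℝ → X → X}
    (h : IsEvolutionFamily T c ω κ Λ B D A) {a : X} (ha : a ∈ D) :
    ∃ u : ℝ → X, IsCauchySolution T D A a u ∧
      (∃ K, LipschitzOnWith K u (Icc 0 T)) ∧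
      (∃ N : Set ℝ, N.Countable ∧ ∀ t ∈ Icc 0 T \ N,
        HasDerivWithinAt u (-A t (u t)) (Icc 0 T) t ∧
          ContinuousWithinAt (fun s => -A s (u s)) (Icc 0 T) t) ∧
      ∀ v : ℝ → X, IsCauchySolution T D A a v → EqOn v u (Icc 0 T) := by
  obtain ⟨u, hua, hD, ⟨K, hK⟩, N, hN, hNu⟩ := h.exists_solution hT ha
  have hu : IsCauchySolution T D A a u :=
    ⟨hK.continuousOn, hua, hD, N, hN, fun t ht => (hNu t ht).1⟩
  exact ⟨u, hu, ⟨K, hK⟩, ⟨N, hN, hNu⟩, fun _ hv => h.eqOn_of_isCauchySolution hu hv⟩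

end EvolutionFamily

section Regularity

variable {X : Type*} [NormedAddCommGroup X] [NormedSpace ℝ X]

lemma apply_eq_polarization {b : X →L[ℝ] X →L[ℝ] ℝ} (hb : ∀ u v, b u v = b v u) (u v : X) :
    b u v = (b (u + v) (u + v) - b u u - b v v) / 2 := by
  simp only [map_add, add_apply, hb v u]
  ring

lemma exists_norm_le_of_abs_apply_self_le [CompleteSpace X] {ι : Type*}
    {b : ι → X →L[ℝ] X →L[ℝ] ℝ} (hsymm : ∀ i u v, b i u v = b i v u)
    (hb : ∀ u, ∃ C, ∀ i, |b i u u| ≤ C) : ∃ C, ∀ i, ‖b i‖ ≤ C := by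
  refine banach_steinhaus fun u => banach_steinhaus fun v => ?_
  obtain ⟨C₁, hC₁⟩ := hb (u + v)
  obtain ⟨C₂, hC₂⟩ := hb u
  obtain ⟨C₃, hC₃⟩ := hb v
  refine ⟨(C₁ + C₂ + C₃) / 2, fun i => ?_⟩
  rw [apply_eq_polarization (hsymm i), Real.norm_eq_abs, abs_div, abs_two]
  gcongr
  exact (abs_sub _ _).trans (add_le_add ((abs_sub _ _).trans (add_le_add (hC₁ i) (hC₂ i))) (hC₃ i))

lemma exists_norm_le_mul_abs [CompleteSpace X] {ι : Type*} {b : ι → X →L[ℝ] X →L[ℝ] ℝ}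
    {r : ι → ℝ} (hsymm : ∀ i u v, b i u v = b i v u)
    (hb : ∀ u, ∃ C, ∀ i, |b i u u| ≤ C * |r i|) : ∃ C, ∀ i, ‖b i‖ ≤ C * |r i| := by
  obtain ⟨C, hC⟩ := exists_norm_le_of_abs_apply_self_le (b := fun i => (r i)⁻¹ • b i)
    (fun i u v => by simp only [smul_apply, hsymm i u v]) fun u => by
      obtain ⟨C, hC⟩ := hb u
      refine ⟨|C|, fun i => ?_⟩
      rw [smul_apply, smul_apply, smul_eq_mul, abs_mul, abs_inv]
      refine inv_mul_le_of_le_mul₀ (abs_nonneg _) (abs_nonneg _) ((hC i).trans ?_)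
      rw [mul_comm]
      exact mul_le_mul_of_nonneg_left (le_abs_self C) (abs_nonneg _)
  refine ⟨C, fun i => (b i).opNorm_le_bound₂
    (mul_nonneg ((norm_nonneg ((r i)⁻¹ • b i)).trans (hC i)) (abs_nonneg _)) fun u v => ?_⟩
  rcases eq_or_ne (r i) 0 with hi | hi
  · have hzero (w : X) : b i w w = 0 := by
      obtain ⟨C', hC'⟩ := hb w
      simpa [hi] using hC' i
    rw [apply_eq_polarization (hsymm i), hzero, hzero, hzero, hi]
    simp
  · have hle := ((r i)⁻¹ • b i).le_of_opNorm₂_le_of_le (hC i) le_rfl le_rfl (x := u) (y := v)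
    rw [smul_apply, smul_apply, norm_smul, norm_inv, inv_mul_le_iff₀ (norm_pos_iff.2 hi)] at hle
    exact hle.trans_eq (by rw [Real.norm_eq_abs]; ring)

lemma continuousOn_of_hasDerivWithinAt_apply_self [CompleteSpace X]
    {B : ℝ → X →L[ℝ] X →L[ℝ] ℝ} {S : Set ℝ} (hsymm : ∀ t ∈ S, ∀ u v, B t u v = B t v u)
    (hderiv : ∀ u, ∀ t ∈ S, ∃ d, HasDerivWithinAt (fun s => B s u u) d S t) :
    ContinuousOn B S := by
  rw [continuousOn_iff_continuous_domRestrict, continuous_iff_seqContinuous]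
  intro x t hx
  have hxt : Tendsto (fun n => (x n : ℝ)) atTop (𝓝 t) := (continuous_subtype_val.tendsto t).comp hx
  have hquad (u : X) : ∃ C, ∀ n, |(B (x n) - B t) u u| ≤ C * |(x n : ℝ) - t| := by
    obtain ⟨d, hd⟩ := hderiv u t t.2
    exact (Asymptotics.isBigO_nat_atTop_iff fun n hn => by
      simp only [Function.comp_apply, sub_eq_zero.1 hn, sub_self]).1
      (hd.hasFDerivWithinAt.isBigO_sub.comp_tendsto
        (tendsto_nhdsWithin_iff.2 ⟨hxt, Eventually.of_forall fun n => (x n).2⟩))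
  obtain ⟨C, hC⟩ := exists_norm_le_mul_abs
    (fun n u v => by simp only [sub_apply, hsymm _ (x n).2 u v, hsymm _ t.2 u v]) hquad
  have hlim : Tendsto (fun n => C * |(x n : ℝ) - t|) atTop (𝓝 0) := by
    simpa using (hxt.sub_const (t : ℝ)).abs.const_mul C
  refine (tendsto_iff_norm_sub_tendsto_zero (b := B t)).2 ?_
  exact squeeze_zero (fun n => norm_nonneg (B (x n) - B t)) hC hlim

lemma le_mul_exp_of_hasDerivWithinAt_le {q q' : ℝ → ℝ} {C a b : ℝ} (hab : a ≤ b)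
    (hq : ∀ t ∈ Icc a b, HasDerivWithinAt q (q' t) (Icc a b) t)
    (hle : ∀ t ∈ Icc a b, q' t ≤ C * q t) : q b ≤ q a * Real.exp (C * (b - a)) := by
  rw [← gronwallBound_ε0]
  refine le_gronwallBound_of_liminf_deriv_right_le (fun t ht => (hq t ht).continuousWithinAt)
    (fun t ht r hr => ?_) le_rfl
    (fun t ht => (hle t (Ico_subset_Icc_self ht)).trans_eq (add_zero _).symm) b ⟨hab, le_rfl⟩
  exact ((hq t (Ico_subset_Icc_self ht)).mono_of_mem_nhdsWithin
    (Icc_mem_nhdsGE_of_mem ht)).liminf_right_slope_le hr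

lemma exists_forall_isCoerciveForm {T c m : ℝ} (hT : 0 ≤ T) (hc : 0 ≤ c)
    {B : ℝ → X →L[ℝ] X →L[ℝ] ℝ} (hsymm : ∀ t ∈ Icc 0 T, ∀ u v, B t u v = B t v u)
    (hnonneg : ∀ t ∈ Icc 0 T, ∀ u, 0 ≤ B t u u)
    (hgrowth : ∀ s ∈ Icc 0 T, ∀ t ∈ Icc 0 T, s ≤ t → ∀ u,
      B t u u ≤ Real.exp (2 * c * (t - s)) * B s u u)
    (hm : 0 < m) (hmT : ∀ u, m * ‖u‖ ≤ formNorm (B T) u) :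
    ∃ κ, ∀ t ∈ Icc 0 T, IsCoerciveForm κ (B t) := by
  have hgrowthT {s t : ℝ} (hs : s ∈ Icc 0 T) (ht : t ∈ Icc 0 T) (hst : s ≤ t) (u : X) :
      formNorm (B t) u ≤ Real.exp (c * T) * formNorm (B s) u := by
    refine (formNorm_le_exp_mul (by rw [← mul_assoc]; exact hgrowth s hs t ht hst u)).trans ?_
    gcongr
    exacts [formNorm_nonneg _ _, by linarith [hs.1, ht.2]]
  refine ⟨Real.exp (c * T) * (m⁻¹ + √‖B 0‖), fun t ht => ⟨by positivity, hsymm t ht, hnonneg t ht,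
    fun u => ?_, fun u => ?_⟩⟩
  · have hle := (hmT u).trans (hgrowthT ht ⟨hT, le_rfl⟩ ht.2 u)
    rw [← le_inv_mul_iff₀ hm] at hle
    have hB0 : 0 ≤ Real.exp (c * T) * √‖B 0‖ * formNorm (B t) u :=
      mul_nonneg (by positivity) (formNorm_nonneg _ _)
    linarith
  · have hle := (hgrowthT ⟨le_rfl, hT⟩ ht ht.1 u).trans
      (mul_le_mul_of_nonneg_left (formNorm_le_sqrt_norm_mul (B 0) u) (Real.exp_nonneg _))
    have hm' : 0 ≤ Real.exp (c * T) * m⁻¹ * ‖u‖ := by positivity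
    linarith

lemma formNorm_le_mul_one_add {κ δ : ℝ} {b b₀ b₁ : X →L[ℝ] X →L[ℝ] ℝ} (hb : IsCoerciveForm κ b)
    (hb₀ : IsCoerciveForm κ b₀) (hb₁ : IsCoerciveForm κ b₁) (hδ : 0 ≤ δ) {u v w : X}
    (h : formNorm b₀ w ≤ δ * (1 + formNorm b₀ u + formNorm b₀ v)) :
    formNorm b₁ w ≤ κ ^ 2 * (1 + κ ^ 2) * δ * (1 + formNorm b u + formNorm b v) := by
  have hle : 1 + formNorm b₀ u + formNorm b₀ v ≤
      (1 + κ ^ 2) * (1 + formNorm b u + formNorm b v) := by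
    linarith [hb.formNorm_le_sq_mul hb₀ u, hb.formNorm_le_sq_mul hb₀ v, formNorm_nonneg b u,
      formNorm_nonneg b v, sq_nonneg κ]
  calc formNorm b₁ w ≤ κ ^ 2 * formNorm b₀ w := hb₀.formNorm_le_sq_mul hb₁ w
    _ ≤ κ ^ 2 * (δ * ((1 + κ ^ 2) * (1 + formNorm b u + formNorm b v))) := by
        gcongr
        exact h.trans (mul_le_mul_of_nonneg_left hle hδ)
    _ = _ := by ring

end Regularity

section InnerProducts

lemma re_inner_comm {𝕜 X : Type*} [RCLike 𝕜] [AddCommGroup X] [Module 𝕜 X]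
    (I : InnerProductSpace.Core 𝕜 X) (u v : X) :
    RCLike.re (I.inner u v) = RCLike.re (I.inner v u) := by
  rw [← I.conj_inner_symm, RCLike.conj_re]

variable {𝕜 X : Type*} [RCLike 𝕜] [NormedAddCommGroup X] [NormedSpace 𝕜 X] [NormedSpace ℝ X]
  [IsScalarTower ℝ 𝕜 X] {I : InnerProductSpace.Core 𝕜 X}

lemma exists_form (hI : IsEquivalentIP I) :
    ∃ b : X →L[ℝ] X →L[ℝ] ℝ, ∀ u v, b u v = RCLike.re (I.inner u v) := by
  obtain ⟨m, M, -, hM⟩ := hI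
  have hadd (u v w : X) : RCLike.re (I.inner (u + v) w) =
      RCLike.re (I.inner u w) + RCLike.re (I.inner v w) := by
    rw [I.add_left, map_add]
  have hsmul (r : ℝ) (u v : X) : RCLike.re (I.inner (r • u) v) = r * RCLike.re (I.inner u v) := by
    rw [RCLike.real_smul_eq_coe_smul (K := 𝕜), I.smul_left, RCLike.conj_ofReal,
      RCLike.re_ofReal_mul]
  have hbound (u v : X) : ‖RCLike.re (I.inner u v)‖ ≤ M ^ 2 * ‖u‖ * ‖v‖ :=
    calc ‖RCLike.re (I.inner u v)‖ ≤ ‖I.inner u v‖ := RCLike.norm_re_le_norm _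
      _ ≤ ipNorm I u * ipNorm I v :=
          @InnerProductSpace.Core.norm_inner_le_norm 𝕜 X _ _ _ I.toCore u v
      _ ≤ (M * ‖u‖) * (M * ‖v‖) := mul_le_mul (hM u).2 (hM v).2 (Real.sqrt_nonneg _)
          ((Real.sqrt_nonneg _).trans (hM u).2)
      _ = M ^ 2 * ‖u‖ * ‖v‖ := by ring
  exact ⟨LinearMap.mkContinuous₂ (LinearMap.mk₂ ℝ (fun u v => RCLike.re (I.inner u v)) hadd hsmul
    (fun u v w => by simp only [re_inner_comm I u, hadd])
    (fun r u v => by simp only [re_inner_comm I u, hsmul, smul_eq_mul])) (M ^ 2) hbound,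
    fun _ _ => rfl⟩

lemma isMaxMonotone_of_isMaximalQuasiMonotone {b : X →L[ℝ] X →L[ℝ] ℝ}
    (hb : ∀ u v, b u v = RCLike.re (I.inner u v)) {ω : ℝ} {D : Set X} {A : X → X}
    (hA : IsMaximalQuasiMonotone I ω D A) : IsMaxMonotone b D (fun x => A x + ω • x) := by
  simp only [IsMaximalQuasiMonotone, ← RCLike.real_smul_eq_coe_smul (K := 𝕜)] at hA
  refine ⟨fun x hx y hy => ?_, fun x y hxy => ?_⟩
  · rw [hb]
    exact hA.prop (x, A x + ω • x) ⟨x, hx, rfl⟩ (y, A y + ω • y) ⟨y, hy, rfl⟩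
  · have hinsert : IsMonotoneOperator I (insert (x, y) (graphOn (fun u => A u + ω • u) D)) := by
      rintro p (rfl | hp) q (rfl | hq)
      · rw [← hb, sub_self, sub_self, map_zero]
      · obtain ⟨z, hz, rfl⟩ := hq
        rw [← hb]
        exact hxy z hz
      · obtain ⟨z, hz, rfl⟩ := hp
        rw [← hb, ← neg_sub y, ← neg_sub x, map_neg, map_neg, neg_apply, neg_neg]
        exact hxy z hz
      · exact hA.prop p hp q hq
    obtain ⟨z, hz, hzxy⟩ := hA.le_of_ge hinsert (subset_insert _ _) (mem_insert (x, y) _)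
    obtain ⟨rfl, rfl⟩ := Prod.mk.inj hzxy
    exact ⟨hz, rfl⟩

lemma exists_isEvolutionFamily [CompleteSpace X] {T c ω L : ℝ} (hT : 0 ≤ T) (hc : 0 ≤ c)
    (hω : 0 ≤ ω) (hL : 0 ≤ L) {I : ℝ → InnerProductSpace.Core 𝕜 X}
    (hI : ∀ t ∈ Icc 0 T, IsEquivalentIP (I t))
    (hdI : ∀ u : X, ∀ t ∈ Icc 0 T, ∃ d : ℝ,
      HasDerivWithinAt (fun s => RCLike.re ((I s).inner u u)) d (Icc 0 T) t ∧
        d ≤ 2 * c * RCLike.re ((I t).inner u u))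
    {D : Set X} {A : ℝ → X → X} (hA : ∀ t ∈ Icc 0 T, IsMaximalQuasiMonotone (I t) ω D (A t))
    (hLip : ∀ u ∈ D, ∀ s ∈ Icc 0 T, ∀ t ∈ Icc 0 T, ipNorm (I 0) (A t u - A s u) ≤
      L * |t - s| * (1 + ipNorm (I 0) u + ipNorm (I 0) (A s u))) :
    ∃ κ Λ B, IsEvolutionFamily T c ω κ Λ B D A := by
  have hzero : (0 : ℝ) ∈ Icc 0 T := ⟨le_rfl, hT⟩
  have hTT : T ∈ Icc 0 T := ⟨hT, le_rfl⟩
  choose! B hB using fun t (ht : t ∈ Icc 0 T) => exists_form (hI t ht)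
  have hnorm {t : ℝ} (ht : t ∈ Icc 0 T) (u : X) : ipNorm (I t) u = formNorm (B t) u := by
    rw [ipNorm, formNorm, hB t ht]
  have hsymm : ∀ t ∈ Icc 0 T, ∀ u v, B t u v = B t v u := fun t ht u v => by
    rw [hB t ht, hB t ht, re_inner_comm]
  have hderiv : ∀ u, ∀ t ∈ Icc 0 T, ∃ d, HasDerivWithinAt (fun s => B s u u) d (Icc 0 T) t ∧
      d ≤ 2 * c * B t u u := fun u t ht => by
    obtain ⟨d, hd, hle⟩ := hdI u t ht
    exact ⟨d, hd.congr (fun s hs => hB s hs u u) (hB t ht u u), by rwa [hB t ht]⟩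
  have hgrowth : ∀ s ∈ Icc 0 T, ∀ t ∈ Icc 0 T, s ≤ t → ∀ u,
      B t u u ≤ Real.exp (2 * c * (t - s)) * B s u u := fun s hs t ht hst u => by
    choose! d hd hle using hderiv u
    have hsub := Icc_subset_Icc hs.1 ht.2
    rw [mul_comm]
    exact le_mul_exp_of_hasDerivWithinAt_le hst (fun r hr => (hd r (hsub hr)).mono hsub)
      fun r hr => hle r (hsub hr)
  obtain ⟨m, M, hm, hmT⟩ := hI T hTT
  obtain ⟨κ, hκ⟩ := exists_forall_isCoerciveForm hT hc hsymm
    (fun t ht u => (hB t ht u u).symm ▸ (I t).re_inner_nonneg u) hgrowth hm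
    fun u => (hmT u).1.trans_eq (hnorm hTT u)
  refine ⟨κ, κ ^ 2 * (1 + κ ^ 2) * L, B, hc, hω, by positivity, hκ, hgrowth,
    continuousOn_of_hasDerivWithinAt_apply_self hsymm fun u t ht => (hderiv u t ht).imp
      fun d hd => hd.1,
    fun t ht => isMaxMonotone_of_isMaximalQuasiMonotone (hB t ht) (hA t ht),
    fun r hr s hs t ht u hu => ?_⟩
  have hLip := hLip u hu s hs t ht
  simp only [hnorm hzero] at hLip
  rw [mul_assoc _ L]
  exact formNorm_le_mul_one_add (hκ s hs) (hκ 0 hzero) (hκ r hr) (by positivity) hLip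

end InnerProducts

theorem mainTheorem4 {𝕜 X : Type*} [RCLike 𝕜] [NormedAddCommGroup X] [InnerProductSpace 𝕜 X]
    [CompleteSpace X] [NormedSpace ℝ X] [IsScalarTower ℝ 𝕜 X]
    (T : ℝ) (hT : 0 < T)
    -- the inner products `(·,·)_t`, each inducing the topology of `X`
    (I : ℝ → InnerProductSpace.Core 𝕜 X)
    (hI : ∀ t ∈ Set.Icc 0 T, IsEquivalentIP (I t))
    -- `d/dt (u,u)_t` exists and is at most `2c (u,u)_t`
    (c : ℝ) (hc : 0 < c)
    (hdI : ∀ u : X, ∀ t ∈ Set.Icc 0 T, ∃ d : ℝ,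
      HasDerivWithinAt (fun s => RCLike.re ((I s).inner u u)) d (Set.Icc 0 T) t ∧
        d ≤ 2 * c * RCLike.re ((I t).inner u u))
    -- the operators `A(t)`, with domain `D`
    (D : Set X) (A : ℝ → X → X)
    (ω : ℝ) (hω : 0 ≤ ω)
    (hA : ∀ t ∈ Set.Icc 0 T, IsMaximalQuasiMonotone (I t) ω D (A t))
    (L : ℝ) (hL : 0 < L)
    (hLip : ∀ u ∈ D, ∀ s ∈ Set.Icc 0 T, ∀ t ∈ Set.Icc 0 T,
      ipNorm (I 0) (A t u - A s u) ≤
        L * |t - s| * (1 + ipNorm (I 0) u + ipNorm (I 0) (A s u)))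
    (a : X) (ha : a ∈ D) :
    ∃ u : ℝ → X, IsCauchySolution T D A a u ∧
      (∃ K, LipschitzOnWith K u (Set.Icc 0 T)) ∧
      (∃ N : Set ℝ, N.Countable ∧ ∀ t ∈ Set.Icc 0 T \ N,
        HasDerivWithinAt u (-(A t (u t))) (Set.Icc 0 T) t ∧
          ContinuousWithinAt (fun s => -(A s (u s))) (Set.Icc 0 T) t) ∧
      ∀ v : ℝ → X, IsCauchySolution T D A a v → Set.EqOn v u (Set.Icc 0 T) := by
  obtain ⟨κ, Λ, B, hfam⟩ := exists_isEvolutionFamily hT.le hc.le hω hL.le hI hdI hA hLip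
  exact mainTheorem4_general hT.le hfam ha
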